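/- Let $K$ be a perfect field, let $n\ge 0$, and let $\mathbb{X}$ be a $0$-dimensional closed subscheme of $\mathbb{P}^n_K$ with saturated homogeneous vanishing ideal $I_{\mathbb{X}}\subseteq P=K[X_0,\dots,X_n]$ and homogeneous coordinate ring $R=P/I_{\mathbb{X}}$ (so $\dim R=1$). Let $x_i$ be the residue class of $X_i$ in $R$, and assume that $x_0$ is a non-zerodivisor of $R$. Let $S=R/\langle x_0-1\rangle$ be the affine coordinate ring of $\mathbb{X}$, and write $f^{\rm deh}$ for the residue class in $S$ of $f\in R$. Let $Q^h(R)$ be the homogeneous ring of quotients of $R$ (fractions $a/b$ with $b$ a homogeneous non-zerodivisor), and let $\widetilde R\subseteq Q^h(R)$ be the subring generated by all homogeneous elements of non-negative degree. For a family $(M_i)_{i\in\mathbb{Z}}$ of finite dimensional homogeneous components of a graded module $M$, the Hilbert function is ${\rm HF}_M(i)=\dim_K M_i$; if it is constant for $i\gg 0$, this constant is denoted by ${\rm HP}(M)$, and ${\rm ri}(M)$ is the least $i\in\mathbb{Z}$ with ${\rm HF}_M(j)={\rm HP}(M)$ for all $j\ge i$. For a graded $K$-algebra $A$, the component $(\Omega^1_{A/K})_i$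 is spanned by the elements $f\,dg$ with $f,g$ homogeneous and $\deg f+\deg g=i$. Then the spaces $R_i$, $(\Omega^1_{R/K})_i$, $S$ and $\Omega^1_{S/K}$ are finite dimensional over $K$, the numbers $r_{\mathbb{X}}={\rm ri}(R)$ and $\deg(\mathbb{X})={\rm HP}(R)$ exist, the canonical map $\iota:R\to\widetilde R$ is injective, and the following hold. (a) There is an isomorphism of graded $K$-algebras $\theta:\widetilde R\to S[x_0]$ with $\theta(\iota(f))=f^{\rm deh}x_0^k$ for $f\in R_k$, and there is an isomorphism of graded $K[x_0]$-modules $$e:\ \Omega^1_{\widetilde R/K}\ \cong\ S[x_0]\,dx_0\ \oplus\ K[x_0]\otimes_K\Omega^1_{S/K}$$ (where $\deg dx_0=1$ and $\Omega^1_{S/K}$ has degree $0$) such that, identifying $\widetilde R$ with $S[x_0]$ via $\theta$, $e(F\,dx_0)=F\,dx_0$ for $F\in S[x_0]$ and $e(s\,x_0^m\,dt)=x_0^m\otimes s\,dt$ for $s,t\in S$, $m\ge0$. The map $\iota$ induces a graded $R$-linear map $\Phi:\Omega^1_{R/K}\to\Omega^1_{\widetilde R/K}$ which, for $f\in R_k$,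 satisfies $$e(\Phi(f\,dx_i))=f^{\rm deh}x_i^{\rm deh}\,x_0^k\,dx_0+x_0^{k+1}\otimes f^{\rm deh}\,dx_i^{\rm deh}\quad(1\le i\le n),\qquad e(\Phi(f\,dx_0))=f^{\rm deh}x_0^k\,dx_0 .$$ (b) For every $i\ge 2r_{\mathbb{X}}+1$, the map $\Phi_i:(\Omega^1_{R/K})_i\to(\Omega^1_{\widetilde R/K})_i$ is bijective. (c) ${\rm HP}(\Omega^1_{R/K})$ and ${\rm ri}(\Omega^1_{R/K})$ exist, ${\rm HP}(\Omega^1_{R/K})=\deg(\mathbb{X})+\dim_K\Omega^1_{S/K}$, and ${\rm ri}(\Omega^1_{R/K})\le 2r_{\mathbb{X}}+1$. (d) ${\rm Ker}(\Phi)$ is the torsion submodule $\{w\in\Omega^1_{R/K}\mid bw=0 \text{ for some homogeneous non-zerodivisor } b\in R\}$. (e) The bound in (c) is sharp: for every perfect field $K$ and every integer $r\ge 0$ there are an $n$ and a scheme $\mathbb{X}\subseteq\mathbb{P}^n_K$ as above with $r_{\mathbb{X}}=r$ and ${\rm ri}(\Omega^1_{R/K})=2r+1$. -/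

import Mathlib

open Filter TensorProduct
open scoped Polynomial

noncomputable section

universe u

/-! ### Hilbert functions -/

/-- The Hilbert function of a vector space with a family of homogeneous components
indexed by the integers. -/
def hilbertFunction (K : Type*) [Field K] {M : Type*} [AddCommGroup M] [Module K M]
    (𝓜 : ℤ → Submodule K M) : ℤ → ℕ :=
  fun i => Module.finrank K (𝓜 i)

/-- `H` has the constant Hilbert polynomial `c`, that is, `H i = c` for `i ≫ 0`. -/
def HasHilbertPolynomial (H : ℤ → ℕ) (c : ℕ) : Prop :=
  ∀ᶠ i in atTop, H i = c

/-- `r` is the regularity index of `H`: the least integer from which on `H` agrees with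
its (constant) Hilbert polynomial. -/
def IsRegularityIndex (H : ℤ → ℕ) (r : ℤ) : Prop :=
  ∃ c, HasHilbertPolynomial H c ∧ IsLeast {i : ℤ | ∀ j, i ≤ j → H j = c} r

/-- The grading of the Kähler differential module of a graded algebra: the component of
degree `i` is spanned by the elements `f dg` with `f`, `g` homogeneous and
`deg f + deg g = i`. -/
def kaehlerComponent (K : Type*) [Field K] {A : Type*} [CommRing A] [Algebra K A]
    (𝒜 : ℤ → Submodule K A) (i : ℤ) : Submodule K (Ω[A⁄K]) :=
  Submodule.span K {w | ∃ a b : ℤ, a + b = i ∧ ∃ f ∈ 𝒜 a, ∃ g ∈ 𝒜 b,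
    w = f • KaehlerDifferential.D K A g}

/-! ### Zero-dimensional subschemes of projective space -/

attribute [local instance] MvPolynomial.gradedAlgebra

/-- A zero-dimensional closed subscheme of projective `n`-space over `K`, given by its
homogeneous vanishing ideal: a saturated homogeneous ideal of `K[X_0, …, X_n]` whose residue
class ring has Krull dimension one. -/
structure ZeroDimSubscheme (K : Type u) [Field K] (n : ℕ) where
  /-- the homogeneous vanishing ideal -/
  ideal : Ideal (MvPolynomial (Fin (n + 1)) K)
  homogeneous : ideal.IsHomogeneous (MvPolynomial.homogeneousSubmodule (Fin (n + 1)) K)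
  saturated : ∀ f : MvPolynomial (Fin (n + 1)) K,
    (∃ k : ℕ, ∀ g ∈ (Ideal.span (Set.range (MvPolynomial.X (R := K) (σ := Fin (n + 1))))) ^ k,
      g * f ∈ ideal) → f ∈ ideal
  dim_eq_one : ringKrullDim (MvPolynomial (Fin (n + 1)) K ⧸ ideal) = 1

namespace ZeroDimSubscheme

variable {K : Type u} [Field K] {n : ℕ} (X : ZeroDimSubscheme K n)

/-- The homogeneous coordinate ring `R`. -/
abbrev coordRing : Type u := MvPolynomial (Fin (n + 1)) K ⧸ X.ideal

/-- The residue class `x_i` of `X_i` in `R`. -/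
def x (i : Fin (n + 1)) : X.coordRing := Ideal.Quotient.mk X.ideal (MvPolynomial.X i)

/-- The homogeneous components `R_i`, which are zero for `i < 0`. -/
def component (i : ℤ) : Submodule K X.coordRing :=
  if 0 ≤ i then
    (MvPolynomial.homogeneousSubmodule (Fin (n + 1)) K i.toNat).map
      (Ideal.Quotient.mkₐ K X.ideal).toLinearMap
  else ⊥

/-- No point of the support lies on the hyperplane `X_0 = 0`: the element `x_0` is a
non-zerodivisor of `R`. -/
def AvoidsHyperplane : Prop := X.x 0 ∈ nonZeroDivisors X.coordRing

/-- The affine coordinate ring `S = R / ⟨x_0 - 1⟩`. -/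
abbrev affineRing : Type u := X.coordRing ⧸ Ideal.span {X.x 0 - 1}

/-- Dehomogenization `f ↦ f^deh`, the residue class map from `R` to `S`. -/
def deh : X.coordRing →ₐ[K] X.affineRing := Ideal.Quotient.mkₐ K _

theorem one_mem_component : (1 : X.coordRing) ∈ X.component 0 := by
  rw [component, if_pos le_rfl]
  exact ⟨1, MvPolynomial.isHomogeneous_one _ _, map_one (Ideal.Quotient.mkₐ K X.ideal)⟩

theorem mul_mem_component {i j : ℤ} {f g : X.coordRing} (hf : f ∈ X.component i)
    (hg : g ∈ X.component j) : f * g ∈ X.component (i + j) := by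
  unfold component at hf hg ⊢
  by_cases hi : 0 ≤ i
  · by_cases hj : 0 ≤ j
    · rw [if_pos hi] at hf
      rw [if_pos hj] at hg
      rw [if_pos (add_nonneg hi hj)]
      obtain ⟨p, hp, rfl⟩ := hf
      obtain ⟨q, hq, rfl⟩ := hg
      refine ⟨p * q, ?_, map_mul (Ideal.Quotient.mkₐ K X.ideal) p q⟩
      rw [Int.toNat_add hi hj]
      exact MvPolynomial.IsHomogeneous.mul hp hq
    · rw [if_neg hj] at hg
      rw [(Submodule.mem_bot K).1 hg, mul_zero]
      exact zero_mem _
  · rw [if_neg hi] at hf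
    rw [(Submodule.mem_bot K).1 hf, zero_mul]
    exact zero_mem _

theorem x_mem_component (i : Fin (n + 1)) : X.x i ∈ X.component 1 := by
  rw [component, if_pos zero_le_one]
  exact ⟨MvPolynomial.X i, MvPolynomial.isHomogeneous_X K i, rfl⟩

/-- The multiplicative set of homogeneous non-zerodivisors of `R`. -/
def homogeneousNonZeroDivisors : Submonoid X.coordRing where
  carrier := {b | b ∈ nonZeroDivisors X.coordRing ∧ ∃ i : ℤ, b ∈ X.component i}
  one_mem' := ⟨one_mem _, 0, X.one_mem_component⟩
  mul_mem' := by
    rintro a b ⟨ha, i, hi⟩ ⟨hb, j, hj⟩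
    exact ⟨mul_mem ha hb, i + j, X.mul_mem_component hi hj⟩

/-- The homogeneous ring of quotients `Q^h(R)`. -/
def quotientRing : Type u := Localization X.homogeneousNonZeroDivisors

instance instCommRingQuotientRing : CommRing X.quotientRing :=
  inferInstanceAs (CommRing (Localization X.homogeneousNonZeroDivisors))

instance instAlgebraQuotientRing : Algebra X.coordRing X.quotientRing :=
  inferInstanceAs (Algebra X.coordRing (Localization X.homogeneousNonZeroDivisors))

instance instAlgebraQuotientRingBase : Algebra K X.quotientRing :=
  inferInstanceAs (Algebra K (Localization X.homogeneousNonZeroDivisors))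

instance instIsScalarTowerQuotientRing : IsScalarTower K X.coordRing X.quotientRing :=
  inferInstanceAs (IsScalarTower K X.coordRing (Localization X.homogeneousNonZeroDivisors))

instance instIsLocalizationQuotientRing :
    IsLocalization X.homogeneousNonZeroDivisors X.quotientRing :=
  inferInstanceAs (IsLocalization X.homogeneousNonZeroDivisors
    (Localization X.homogeneousNonZeroDivisors))

/-- The component of degree `d` of `Q^h(R)`: it consists of the fractions `a / b` with `a`, `b`
homogeneous, `b` a non-zerodivisor, and `deg a - deg b = d`. -/
def quotientComponent (d : ℤ) : Submodule K X.quotientRing :=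
  Submodule.span K {q | ∃ (i j : ℤ) (a : X.coordRing) (b : X.homogeneousNonZeroDivisors),
    a ∈ X.component i ∧ (b : X.coordRing) ∈ X.component j ∧ i - j = d ∧
      q = IsLocalization.mk' X.quotientRing a b}

/-- The truncated integral closure of `R`: the subring of `Q^h(R)` that is generated by the
homogeneous elements of non-negative degree (among them are the elements of `K`). -/
def truncSubalgebra : Subalgebra K X.quotientRing :=
  Algebra.adjoin K {q | ∃ d : ℤ, 0 ≤ d ∧ q ∈ X.quotientComponent d}

/-- The truncated integral closure of `R`, as a type. -/
abbrev truncClosure : Type u := X.truncSubalgebra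

/-- The homogeneous components of the truncated integral closure. -/
def truncComponent (d : ℤ) : Submodule K X.truncClosure :=
  (X.quotientComponent d).comap X.truncSubalgebra.val.toLinearMap

theorem algebraMap_mem_truncSubalgebra (f : X.coordRing) :
    algebraMap X.coordRing X.quotientRing f ∈ X.truncSubalgebra := by
  obtain ⟨p, rfl⟩ := Ideal.Quotient.mk_surjective f
  induction p using MvPolynomial.induction_on with
  | C a =>
    have h : algebraMap X.coordRing X.quotientRing
        (Ideal.Quotient.mk X.ideal (MvPolynomial.C a)) = algebraMap K X.quotientRing a :=
      (IsScalarTower.algebraMap_apply K X.coordRing X.quotientRing a).symm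
    rw [h]
    exact Subalgebra.algebraMap_mem _ a
  | add p q hp hq =>
    rw [map_add, map_add]
    exact add_mem hp hq
  | mul_X p i hp =>
    rw [map_mul, map_mul]
    refine mul_mem hp (Algebra.subset_adjoin ⟨1, zero_le_one, Submodule.subset_span ?_⟩)
    refine ⟨1, 0, X.x i, 1, X.x_mem_component i, X.one_mem_component, by norm_num, ?_⟩
    exact (IsLocalization.mk'_one X.quotientRing (X.x i)).symm

/-- The canonical map from `R` to its truncated integral closure. -/
def incl : X.coordRing →ₐ[K] X.truncClosure :=
  AlgHom.codRestrict (IsScalarTower.toAlgHom K X.coordRing X.quotientRing) X.truncSubalgebra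
    X.algebraMap_mem_truncSubalgebra

instance instAlgebraTruncClosure : Algebra X.coordRing X.truncClosure :=
  X.incl.toRingHom.toAlgebra

instance instIsScalarTowerTruncClosure : IsScalarTower K X.coordRing X.truncClosure :=
  IsScalarTower.of_algebraMap_eq fun a => (X.incl.commutes a).symm

/-- The canonical `R`-linear map between the Kähler differential modules of `R` and of its
truncated integral closure; it sends `f dg` to `f dg`. -/
def Phi : Ω[X.coordRing⁄K] →ₗ[X.coordRing] Ω[X.truncClosure⁄K] :=
  KaehlerDifferential.map K K X.coordRing X.truncClosure

/-- The torsion submodule of the Kähler differential module of `R`: all elements that are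
annihilated by some homogeneous non-zerodivisor of `R`. -/
def torsionKaehler : Submodule X.coordRing (Ω[X.coordRing⁄K]) :=
  Submodule.torsion' X.coordRing (Ω[X.coordRing⁄K]) X.homogeneousNonZeroDivisors

/-- The component of degree `i` of `S[x_0]`, namely `S x_0^i`. -/
def polyComponent (i : ℤ) : Submodule K X.affineRing[X] :=
  Submodule.span K {F | ∃ (m : ℕ) (s : X.affineRing), (m : ℤ) = i ∧
    F = Polynomial.monomial m s}

/-- The module `S[x_0] dx_0 ⊕ (K[x_0] ⊗ Ω¹_{S/K})`; the first entry of a pair is the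
coefficient of `dx_0`. -/
abbrev splitModule : Type u := X.affineRing[X] × (K[X] ⊗[K] Ω[X.affineRing⁄K])

/-- The component of degree `i` of `S[x_0] dx_0 ⊕ (K[x_0] ⊗ Ω¹_{S/K})`, where `dx_0` has
degree one and the elements of `Ω¹_{S/K}` have degree zero. -/
def splitComponent (i : ℤ) : Submodule K X.splitModule :=
  Submodule.span K
    ({w | ∃ (m : ℕ) (s : X.affineRing), (m : ℤ) + 1 = i ∧ w = (Polynomial.monomial m s, 0)} ∪
      {w | ∃ (m : ℕ) (η : Ω[X.affineRing⁄K]), (m : ℤ) = i ∧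
        w = (0, (Polynomial.X ^ m : K[X]) ⊗ₜ[K] η)})

end ZeroDimSubscheme

end

/-!
Write `I` for the vanishing ideal, `r` for the regularity index of `R`, and `δ : R → A` for the
dehomogenization. All that is used about `δ` is `ZeroDimSubscheme.IsDehomogenization`: it is
surjective, maps `x_0` to `1`, and is injective on each `R_i`. So the spaces `δ(R_i)` form an
ascending chain that exhausts the finite dimensional algebra `A`. Therefore the Hilbert polynomial
of `R` is `dim A`, every element of `A` comes from `R_i` as soon as `r ≤ i`, and `x_0 : R_i →
R_{i+1}` is onto for these `i`.

Homogeneous non-zerodivisors become units in `A`, and `a / b ↦ δ(a) δ(b)⁻¹ T^(deg a - deg b)`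
identifies `Q^h(R)` with the graded ring `A[T, T⁻¹]` and the truncated integral closure with
`A[T]` (`truncEquiv`). A direct computation of the Kähler differentials of a polynomial ring over
`A` (`polynomialKaehlerEquiv`) then gives the splitting `splitEquiv`. The kernel of `Φ` is the
torsion, because the module of differentials of the localization `Q^h(R)` of `R` is the
localization of `Ω¹_{R/K}`, while homogeneous non-zerodivisors of `R` act injectively on the
differentials of `A[T]`.

Bijectivity of `Φ` in the degrees `i ≥ 2r + 1` has two sides. For surjectivity, `s dt` lifts to `f
dg` with `f` and `g` of degree at least `r`, up to a multiple of `dx_0` (`surjOn_Phi`). For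
injectivity, some power of `x_0` kills the kernel, so that it is enough that `x_0` acts
injectively in these degrees (`eq_zero_of_x_zero_smul_eq_zero`). If `x_0 ∑ F_j dx_j = 0`, then
there is a form `G ∈ I` of degree `i + 1` with `X_0 F_j ≡ ∂G/∂X_j` modulo `I`. The key point is
that `i + 1 ≥ 2r + 2`: `G` is a sum of products of two forms of degrees greater than `r`, each of
which is a multiple of `X_0` modulo `I`, whence `G ≡ X_0 q` modulo `I²`
(`exists_sub_X_zero_mul_mem_sq`). It follows that `q ∈ I`, that `F_j ≡ ∂q/∂X_j`, and that `∑ F_j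
dx_j = dq = 0`.

The bound is attained by the subscheme of the projective line that is defined by the
homogenization `F` of a separable polynomial of degree `r + 1`. If `r > 0`, division of the
coefficients of `x_1^r dF = 0` by `x_0` produces a nonzero torsion form of degree `2r`
(`exists_ne_zero_Phi_eq_zero`), whereas `Φ` is still surjective in this degree. If `r = 0`, then
`Ω¹_{R/K}` has no nonzero elements of degree `0`.
-/

noncomputable section

attribute [local instance] MvPolynomial.gradedAlgebra

section KaehlerPolynomial

open KaehlerDifferential

/-! ### Kähler differentials of a polynomial ring -/

theorem kaehlerDifferential_induction {K A : Type*} [CommRing K] [CommRing A] [Algebra K A]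
    {p : Ω[A⁄K] → Prop} (w : Ω[A⁄K]) (zero : p 0) (add : ∀ v w, p v → p w → p (v + w))
    (smul_D : ∀ a b : A, p (a • D K A b)) : p w := by
  obtain ⟨x, rfl⟩ := linearCombination_surjective K A w
  induction x using Finsupp.induction_linear with
  | zero => simpa using zero
  | add x y hx hy => simpa using add _ _ hx hy
  | single b a => simpa using smul_D a b

theorem kaehlerDifferential_smul_comm {K A : Type*} [CommRing K] [CommRing A] [Algebra K A]
    (c : K) (a : A) (w : Ω[A⁄K]) : c • a • w = a • c • w := by
  rw [← algebraMap_smul A c, ← algebraMap_smul A c, smul_smul, smul_smul, mul_comm]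

theorem finite_kaehlerDifferential (K A : Type*) [Field K] [CommRing A] [Algebra K A]
    [Module.Finite K A] : Module.Finite K (Ω[A⁄K]) :=
  Module.Finite.trans A _

section Functoriality

variable {K A B : Type*} [CommRing K] [CommRing A] [CommRing B] [Algebra K A] [Algebra K B]

/-- The map `f dg ↦ φ(f) dφ(g)` that a homomorphism `φ` of `K`-algebras induces on Kähler
differentials. -/
def kaehlerMapHom (φ : A →ₐ[K] B) : Ω[A⁄K] →ₗ[K] Ω[B⁄K] :=
  letI := φ.toRingHom.toAlgebra
  haveI : IsScalarTower K A B := IsScalarTower.of_algebraMap_eq fun a => (φ.commutes a).symm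
  (KaehlerDifferential.map K K A B).restrictScalars K

theorem kaehlerMapHom_smul (φ : A →ₐ[K] B) (a : A) (w : Ω[A⁄K]) :
    kaehlerMapHom φ (a • w) = φ a • kaehlerMapHom φ w := by
  let := φ.toRingHom.toAlgebra
  have : IsScalarTower K A B := IsScalarTower.of_algebraMap_eq fun a => (φ.commutes a).symm
  exact (KaehlerDifferential.map K K A B).map_smul a w

theorem kaehlerMapHom_D (φ : A →ₐ[K] B) (a : A) :
    kaehlerMapHom φ (D K A a) = D K B (φ a) := by
  let := φ.toRingHom.toAlgebra
  have : IsScalarTower K A B := IsScalarTower.of_algebraMap_eq fun a => (φ.commutes a).symm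
  exact KaehlerDifferential.map_D K K A B a

theorem kaehlerMapHom_kaehlerMapHom_of_leftInverse (φ : A →ₐ[K] B) (ψ : B →ₐ[K] A)
    (h : Function.LeftInverse ψ φ) (w : Ω[A⁄K]) : kaehlerMapHom ψ (kaehlerMapHom φ w) = w := by
  induction w using kaehlerDifferential_induction with
  | zero => simp
  | add v w hv hw => rw [map_add, map_add, hv, hw]
  | smul_D a b => rw [kaehlerMapHom_smul, kaehlerMapHom_smul, kaehlerMapHom_D, kaehlerMapHom_D,
      h, h]

/-- The isomorphism of Kähler differentials that an isomorphism of algebras induces. -/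
def kaehlerCongr (θ : A ≃ₐ[K] B) : Ω[A⁄K] ≃ₗ[K] Ω[B⁄K] :=
  { kaehlerMapHom (θ : A →ₐ[K] B) with
    invFun := kaehlerMapHom (θ.symm : B →ₐ[K] A)
    left_inv := kaehlerMapHom_kaehlerMapHom_of_leftInverse (θ : A →ₐ[K] B) (θ.symm : B →ₐ[K] A)
      θ.symm_apply_apply
    right_inv := kaehlerMapHom_kaehlerMapHom_of_leftInverse (θ.symm : B →ₐ[K] A) (θ : A →ₐ[K] B)
      θ.apply_symm_apply }

theorem kaehlerCongr_smul (θ : A ≃ₐ[K] B) (a : A) (w : Ω[A⁄K]) :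
    kaehlerCongr θ (a • w) = θ a • kaehlerCongr θ w :=
  kaehlerMapHom_smul (θ : A →ₐ[K] B) a w

theorem kaehlerCongr_D (θ : A ≃ₐ[K] B) (a : A) :
    kaehlerCongr θ (D K A a) = D K B (θ a) :=
  kaehlerMapHom_D (θ : A →ₐ[K] B) a

end Functoriality

theorem KaehlerDifferential.map_map_apply {K A B C : Type*} [CommRing K] [CommRing A] [CommRing B]
    [CommRing C] [Algebra K A] [Algebra K B] [Algebra K C] [Algebra A B] [Algebra A C]
    [Algebra B C] [IsScalarTower K A B] [IsScalarTower K A C] [IsScalarTower K B C]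
    [IsScalarTower A B C] (w : Ω[A⁄K]) :
    KaehlerDifferential.map K K B C (KaehlerDifferential.map K K A B w) =
      KaehlerDifferential.map K K A C w := by
  induction w using kaehlerDifferential_induction with
  | zero => simp
  | add v w hv hw => simp [hv, hw]
  | smul_D a b =>
    rw [(KaehlerDifferential.map K K A B).map_smul, (KaehlerDifferential.map K K A C).map_smul,
      KaehlerDifferential.map_D, KaehlerDifferential.map_D, ← algebraMap_smul B a,
      (KaehlerDifferential.map K K B C).map_smul, KaehlerDifferential.map_D, algebraMap_smul,
      ← IsScalarTower.algebraMap_apply]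

section PolynomialKaehler

variable (K S : Type*) [CommRing K] [CommRing S] [Algebra K S]

/-- The `K`-derivation `F ↦ (∂F/∂X, d_S F)` of `S[X]`, where `d_S` differentiates the
coefficients. -/
def polynomialDerivation : Derivation K S[X] (S[X] × PolynomialModule S (Ω[S⁄K])) where
  toLinearMap := LinearMap.prod
    ((Polynomial.derivative' (R := S)).toLinearMap.restrictScalars K)
    (Derivation.mapCoeffs (D K S)).toLinearMap
  map_one_eq_zero' := by
    ext : 1
    · simp
    · exact (Derivation.mapCoeffs (D K S)).map_one_eq_zero
  leibniz' a b := by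
    ext : 1
    · exact (Polynomial.derivative' (R := S)).leibniz a b
    · exact (Derivation.mapCoeffs (D K S)).leibniz a b

theorem polynomialDerivation_apply (p : S[X]) :
    polynomialDerivation K S p = (Polynomial.derivative p, (D K S).mapCoeffs p) := rfl

/-- The map that sends a polynomial `∑ ηₙ Xⁿ` with coefficients in `Ω¹_{S/K}` to `∑ Xⁿ ηₙ`. -/
def polynomialModuleToKaehler : PolynomialModule S (Ω[S⁄K]) →ₗ[S[X]] Ω[S[X]⁄K] where
  toFun q := PolynomialModule.eval (Polynomial.X : S[X])
    (PolynomialModule.map S[X] (KaehlerDifferential.map K K S S[X]) q)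
  map_add' p q := by simp
  map_smul' p q := by
    rw [PolynomialModule.map_smul, PolynomialModule.eval_smul, RingHom.id_apply,
      Polynomial.eval_map_algebraMap, Polynomial.aeval_X_left_apply]

theorem polynomialModuleToKaehler_single (n : ℕ) (η : Ω[S⁄K]) :
    polynomialModuleToKaehler K S (PolynomialModule.single S n η) =
      (Polynomial.X ^ n : S[X]) • KaehlerDifferential.map K K S S[X] η := by
  simp [polynomialModuleToKaehler]

theorem D_polynomial (p : S[X]) :
    D K S[X] p = polynomialModuleToKaehler K S ((D K S).mapCoeffs p) +
      Polynomial.derivative p • D K S[X] Polynomial.X := by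
  have h := Derivation.apply_aeval_eq' (D K S) (D K S[X]) (KaehlerDifferential.map K K S S[X])
    (fun a => by simp) Polynomial.X p
  rwa [Polynomial.aeval_X_left_apply, Polynomial.aeval_X_left_apply] at h

theorem lift_polynomialDerivation_map (η : Ω[S⁄K]) :
    (polynomialDerivation K S).liftKaehlerDifferential
      (KaehlerDifferential.map K K S S[X] η) = (0, PolynomialModule.single S 0 η) := by
  induction η using kaehlerDifferential_induction with
  | zero => simp; rfl
  | add v w hv hw => simp [hv, hw]
  | smul_D a b =>
    rw [map_smul, KaehlerDifferential.map_D, ← algebraMap_smul S[X] a, map_smul,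
      Derivation.liftKaehlerDifferential_comp_D, polynomialDerivation_apply]
    ext : 1
    · simp
    · simp [← Polynomial.monomial_zero_left]

theorem lift_polynomialDerivation_polynomialModuleToKaehler (q : PolynomialModule S (Ω[S⁄K])) :
    (polynomialDerivation K S).liftKaehlerDifferential
      (polynomialModuleToKaehler K S q) = (0, q) := by
  induction q using PolynomialModule.induction_linear with
  | zero => simp; rfl
  | add p q hp hq => rw [map_add, map_add, hp, hq]; simp
  | single n η =>
    rw [polynomialModuleToKaehler_single, map_smul, lift_polynomialDerivation_map]
    ext : 1
    · simp
    · simp [Polynomial.X_pow_eq_monomial]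

/-- `Ω¹_{S[X]/K}` is the direct sum of `S[X] dX` and of the polynomials with coefficients in
`Ω¹_{S/K}`. -/
def polynomialKaehlerEquiv : Ω[S[X]⁄K] ≃ₗ[S[X]] S[X] × PolynomialModule S (Ω[S⁄K]) :=
  LinearEquiv.ofLinearMap (polynomialDerivation K S).liftKaehlerDifferential
    (LinearMap.coprod (LinearMap.toSpanSingleton S[X] _ (D K S[X] Polynomial.X))
      (polynomialModuleToKaehler K S))
    (by
      apply LinearMap.ext
      rintro ⟨F, q⟩
      have h1 : (polynomialDerivation K S).liftKaehlerDifferential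
          (F • D K S[X] Polynomial.X) = (F, 0) := by
        rw [map_smul, Derivation.liftKaehlerDifferential_comp_D, polynomialDerivation_apply]
        simp
      rw [LinearMap.comp_apply, LinearMap.coprod_apply, LinearMap.toSpanSingleton_apply, map_add,
        h1, lift_polynomialDerivation_polynomialModuleToKaehler]
      simp)
    (by
      refine LinearMap.ext fun w => ?_
      induction w using kaehlerDifferential_induction with
      | zero => simp
      | add v w hv hw => rw [map_add, hv, hw, map_add]
      | smul_D a b =>
        rw [map_smul, LinearMap.comp_apply, Derivation.liftKaehlerDifferential_comp_D,
          polynomialDerivation_apply, LinearMap.coprod_apply, LinearMap.toSpanSingleton_apply,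
          add_comm, ← D_polynomial, LinearMap.id_apply])

theorem polynomialKaehlerEquiv_D (p : S[X]) :
    polynomialKaehlerEquiv K S (D K S[X] p) =
      (Polynomial.derivative p, (D K S).mapCoeffs p) :=
  Derivation.liftKaehlerDifferential_comp_D _ _

end PolynomialKaehler

section SplitTensor

variable (K S : Type*) [Field K] [CommRing S] (M : Type*) [AddCommGroup M]
  [Module K M] [Module S M]

/-- Polynomials with coefficients in `M` are the elements of `K[X] ⊗ M`. -/
def polynomialModuleEquivTensor : PolynomialModule S M ≃ₗ[K] K[X] ⊗[K] M :=
  (PolynomialModule.coeffLinearEquiv S K).trans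
    ((TensorProduct.finsuppScalarLeft K M ℕ).symm.trans
      (LinearEquiv.rTensor M (Polynomial.basisMonomials K).repr.symm))

theorem polynomialModuleEquivTensor_single (n : ℕ) (m : M) :
    polynomialModuleEquivTensor K S M (PolynomialModule.single S n m) =
      (Polynomial.X ^ n : K[X]) ⊗ₜ[K] m := by
  simp [polynomialModuleEquivTensor, Polynomial.X_pow_eq_monomial]

theorem polynomialModuleEquivTensor_X_smul (q : PolynomialModule S M) :
    polynomialModuleEquivTensor K S M ((Polynomial.X : S[X]) • q) =
      (Polynomial.X : K[X]) • polynomialModuleEquivTensor K S M q := by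
  induction q using PolynomialModule.induction_linear with
  | zero => simp
  | add p q hp hq => rw [smul_add, map_add, hp, hq, map_add, smul_add]
  | single n η =>
    rw [← Polynomial.monomial_one_one_eq_X, PolynomialModule.monomial_smul_single,
      polynomialModuleEquivTensor_single, polynomialModuleEquivTensor_single,
      TensorProduct.smul_tmul', one_smul, smul_eq_mul, pow_add, pow_one]

end SplitTensor

end KaehlerPolynomial

/-! ### Regularity indices of integer functions -/

theorem IsRegularityIndex.eq_of_le {H : ℤ → ℕ} {r : ℤ} {c : ℕ} (hr : IsRegularityIndex H r)
    (hc : HasHilbertPolynomial H c) {i : ℤ} (hi : r ≤ i) : H i = c := by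
  obtain ⟨c', hc', hr'⟩ := hr
  obtain ⟨j, hj, hj'⟩ := (hc.and hc').exists
  rw [hr'.1 i hi, ← hj', hj]

theorem exists_isRegularityIndex {H : ℤ → ℕ} {c : ℕ} {m : ℤ} (hneg : ∀ i < 0, H i = 0)
    (hc : c ≠ 0) (hm : ∀ i, m ≤ i → H i = c) : ∃ r ≤ m, IsRegularityIndex H r := by
  have hbdd : BddBelow {i : ℤ | ∀ j, i ≤ j → H j = c} := by
    refine ⟨0, fun i hi => ?_⟩
    by_contra! h
    exact hc ((hi i le_rfl).symm.trans (hneg i h))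
  have hne : {i : ℤ | ∀ j, i ≤ j → H j = c}.Nonempty := ⟨m, hm⟩
  exact ⟨_, csInf_le hbdd hm, c, eventually_atTop.2 ⟨m, hm⟩, Int.csInf_mem hne hbdd,
    fun i hi => csInf_le hbdd hi⟩

theorem isRegularityIndex_of_ne {H : ℤ → ℕ} {c : ℕ} {m : ℤ} (hm : ∀ i, m ≤ i → H i = c)
    (hne : H (m - 1) ≠ c) : IsRegularityIndex H m := by
  refine ⟨c, eventually_atTop.2 ⟨m, hm⟩, hm, fun i hi => ?_⟩
  by_contra! h
  exact hne (hi _ (by omega))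

/-! ### Homogeneous polynomials -/

/-- Homogeneous polynomials of degree `k` pull a common factor `t` of the arguments out
as `t ^ k`. -/
theorem MvPolynomial.IsHomogeneous.aeval_mul_right {σ K A : Type*} [CommSemiring K]
    [CommSemiring A] [Algebra K A] {p : MvPolynomial σ K} {k : ℕ} (hp : p.IsHomogeneous k)
    (c : σ → A) (t : A) :
    MvPolynomial.aeval (fun i => c i * t) p = MvPolynomial.aeval c p * t ^ k := by
  rw [MvPolynomial.aeval_def, MvPolynomial.aeval_def, MvPolynomial.eval₂_eq,
    MvPolynomial.eval₂_eq, Finset.sum_mul]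
  refine Finset.sum_congr rfl fun d hd => ?_
  simp only [mul_pow, Finset.prod_mul_distrib, Finset.prod_pow_eq_pow_sum]
  rw [hp.degree_eq_sum_deg_support hd, mul_assoc]

namespace ZeroDimSubscheme

variable {K : Type u} [Field K] {n : ℕ} (X : ZeroDimSubscheme K n)

/-! ### The homogeneous components of the coordinate ring -/

theorem mem_component_natCast {k : ℕ} {f : X.coordRing} :
    f ∈ X.component k ↔
      ∃ p : MvPolynomial (Fin (n + 1)) K, p.IsHomogeneous k ∧ Ideal.Quotient.mk X.ideal p = f := by
  rw [component, if_pos (Int.natCast_nonneg k), Int.toNat_natCast, Submodule.mem_map]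
  rfl

theorem component_of_neg {i : ℤ} (hi : i < 0) : X.component i = ⊥ := by
  rw [component, if_neg (not_le.2 hi)]

theorem mk_mem_component {k : ℕ} {p : MvPolynomial (Fin (n + 1)) K} (hp : p.IsHomogeneous k) :
    Ideal.Quotient.mk X.ideal p ∈ X.component k :=
  X.mem_component_natCast.2 ⟨p, hp, rfl⟩

/-- Every element of `R` is the sum of its homogeneous components. -/
theorem component_induction {p : X.coordRing → Prop} (f : X.coordRing)
    (homogeneous : ∀ (k : ℕ), ∀ f ∈ X.component k, p f) (zero : p 0)
    (add : ∀ f g, p f → p g → p (f + g)) : p f := by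
  obtain ⟨q, rfl⟩ := Ideal.Quotient.mk_surjective f
  rw [← MvPolynomial.sum_homogeneousComponent q, map_sum]
  exact Finset.sum_induction _ p add zero fun k _ =>
    homogeneous k _ (X.mk_mem_component (MvPolynomial.homogeneousComponent_isHomogeneous k q))

/-- For a homomorphism `φ : R → A`, the homomorphism `R → A[T]` that sends a homogeneous
element `f` of degree `k` to `φ(f) T^k`. -/
def gradedLift {A : Type*} [CommRing A] [Algebra K A] (φ : X.coordRing →ₐ[K] A) :
    X.coordRing →ₐ[K] A[X] :=
  Ideal.Quotient.liftₐ X.ideal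
    (MvPolynomial.aeval fun i => Polynomial.C (φ (X.x i)) * Polynomial.X) (by
      intro p hp
      rw [← MvPolynomial.sum_homogeneousComponent p, map_sum]
      refine Finset.sum_eq_zero fun k _ => ?_
      have hk := MvPolynomial.homogeneousComponent_mem_of_mem X.homogeneous hp k
      rw [(MvPolynomial.homogeneousComponent_isHomogeneous k p).aeval_mul_right
        (fun i => Polynomial.C (φ (X.x i)))]
      have h : (MvPolynomial.aeval fun i => Polynomial.C (φ (X.x i))) =
          ((Polynomial.CAlgHom (R := K) (A := A)).comp φ).comp
            (Ideal.Quotient.mkₐ K X.ideal) := by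
        ext i
        simp [x]
      rw [h, AlgHom.comp_apply, Ideal.Quotient.mkₐ_eq_mk, Ideal.Quotient.eq_zero_iff_mem.2 hk,
        map_zero, zero_mul])

theorem gradedLift_of_mem {A : Type*} [CommRing A] [Algebra K A] (φ : X.coordRing →ₐ[K] A)
    {k : ℕ} {f : X.coordRing} (hf : f ∈ X.component k) :
    X.gradedLift φ f = Polynomial.monomial k (φ f) := by
  obtain ⟨p, hp, rfl⟩ := X.mem_component_natCast.1 hf
  have h : (MvPolynomial.aeval fun i => Polynomial.C (φ (X.x i))) =
      ((Polynomial.CAlgHom (R := K) (A := A)).comp φ).comp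
        (Ideal.Quotient.mkₐ K X.ideal) := by
    ext i
    simp [x]
  change MvPolynomial.aeval (fun i => Polynomial.C (φ (X.x i)) * Polynomial.X) p = _
  rw [hp.aeval_mul_right (fun i => Polynomial.C (φ (X.x i))), h]
  exact Polynomial.C_mul_X_pow_eq_monomial

theorem coeff_gradedLift {A : Type*} [CommRing A] [Algebra K A] (φ : X.coordRing →ₐ[K] A)
    (f : X.coordRing) (k : ℕ) :
    (X.gradedLift φ f).coeff k = φ ((X.gradedLift (AlgHom.id K _) f).coeff k) := by
  induction f using X.component_induction with
  | homogeneous j f hf =>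
    rw [X.gradedLift_of_mem _ hf, X.gradedLift_of_mem _ hf, Polynomial.coeff_monomial,
      Polynomial.coeff_monomial]
    split_ifs <;> simp
  | zero => simp
  | add f g hf hg => simp [hf, hg]

theorem coeff_gradedLift_id_mem (f : X.coordRing) (k : ℕ) :
    (X.gradedLift (AlgHom.id K _) f).coeff k ∈ X.component k := by
  induction f using X.component_induction with
  | homogeneous j f hf =>
    rw [X.gradedLift_of_mem _ hf, Polynomial.coeff_monomial]
    split_ifs with h
    · exact h ▸ hf
    · exact zero_mem _
  | zero => simp
  | add f g hf hg => simpa using add_mem hf hg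

/-- The substitution `T = 1` is a left inverse. -/
theorem gradedLift_id_injective : Function.Injective (X.gradedLift (AlgHom.id K _)) := by
  have h : ∀ f, (X.gradedLift (AlgHom.id K _) f).eval 1 = f := by
    intro f
    induction f using X.component_induction with
    | homogeneous j f hf => simp [X.gradedLift_of_mem _ hf]
    | zero => simp
    | add f g hf hg => simp [hf, hg]
  exact Function.LeftInverse.injective h

variable {X}

/-- Dehomogenization is injective on each homogeneous component: in an equation
`f = (x_0 - 1) g` with `f` homogeneous, the components of `g` below and from the degree of `f`
on vanish. -/
theorem eq_zero_of_deh_eq_zero (hX : X.AvoidsHyperplane) {k : ℕ} {f : X.coordRing}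
    (hf : f ∈ X.component k) (h : X.deh f = 0) : f = 0 := by
  obtain ⟨g, hg⟩ := Ideal.mem_span_singleton'.1 (Ideal.Quotient.eq_zero_iff_mem.1 h)
  set G := X.gradedLift (AlgHom.id K _) g
  have h0 : X.gradedLift (AlgHom.id K _) f = Polynomial.C (X.x 0) * (G * Polynomial.X) - G := by
    rw [← hg, map_mul, map_sub, map_one, X.gradedLift_of_mem (k := 1) _ (X.x_mem_component 0),
      ← Polynomial.C_mul_X_eq_monomial]
    simp only [AlgHom.coe_id, id_eq]
    ring
  rw [X.gradedLift_of_mem _ hf, AlgHom.id_apply] at h0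
  have hc0 : G.coeff 0 = - if k = 0 then f else 0 := by
    have := congrArg (Polynomial.coeff · 0) h0
    simp only [Polynomial.coeff_monomial, Polynomial.coeff_sub, Polynomial.coeff_C_mul,
      Polynomial.coeff_mul_X_zero] at this
    rw [this]; ring
  have hc : ∀ m, G.coeff (m + 1) = X.x 0 * G.coeff m - if k = m + 1 then f else 0 := by
    intro m
    have := congrArg (Polynomial.coeff · (m + 1)) h0
    simp only [Polynomial.coeff_monomial, Polynomial.coeff_sub, Polynomial.coeff_C_mul,
      Polynomial.coeff_mul_X] at this
    rw [this]; ring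
  have hlow : ∀ m < k, G.coeff m = 0 := by
    intro m
    induction m with
    | zero => intro hm; rw [hc0, if_neg (by omega), neg_zero]
    | succ m ih => intro hm; rw [hc, ih (by omega), if_neg (by omega), mul_zero, sub_zero]
  have hk : G.coeff k = -f := by
    rcases k with _ | k
    · simpa using hc0
    · rw [hc, hlow k (by omega)]; simp
  have hhigh : ∀ j, G.coeff (k + j) = X.x 0 ^ j * -f := by
    intro j
    induction j with
    | zero => simpa using hk
    | succ j ih => rw [← add_assoc, hc, ih, if_neg (by omega), pow_succ']; ring
  have hz := hhigh (G.natDegree + 1)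
  rw [Polynomial.coeff_eq_zero_of_natDegree_lt (by omega)] at hz
  have := (mul_left_mem_nonZeroDivisors_eq_zero_iff (pow_mem hX _)).1 hz.symm
  exact neg_eq_zero.1 this

/-- If `(x_0 - 1) g = 0`, then the components of `g` vanish by induction on the degree. -/
theorem x_zero_sub_one_mem_nonZeroDivisors : X.x 0 - 1 ∈ nonZeroDivisors X.coordRing := by
  rw [mem_nonZeroDivisors_iff_right]
  intro g hg
  set G := X.gradedLift (AlgHom.id K _) g with hG
  have h0 : (0 : X.coordRing[X]) = Polynomial.C (X.x 0) * (G * Polynomial.X) - G := by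
    rw [← map_zero (X.gradedLift (AlgHom.id K _)), ← hg, map_mul, map_sub, map_one,
      X.gradedLift_of_mem (k := 1) _ (X.x_mem_component 0), ← Polynomial.C_mul_X_eq_monomial]
    simp only [AlgHom.coe_id, id_eq]
    ring
  have hz : ∀ m, G.coeff m = 0 := by
    intro m
    induction m with
    | zero => simpa using congrArg (Polynomial.coeff · 0) h0
    | succ m ih => simpa [ih] using congrArg (Polynomial.coeff · (m + 1)) h0
  refine X.gradedLift_id_injective ?_
  rw [← hG, map_zero]
  exact Polynomial.ext hz

/-! ### Dehomogenization -/

variable (X) in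
theorem deh_x_zero : X.deh (X.x 0) = 1 := by
  rw [← sub_eq_zero, ← map_one X.deh, ← map_sub]
  exact Ideal.Quotient.eq_zero_iff_mem.2 (Ideal.mem_span_singleton_self _)

variable (X) in
/-- `δ : R → A` exhibits `A` as the affine coordinate ring: it is surjective, it sends `x_0` to
`1`, and it is injective on the homogeneous components of `R`. Besides `S = R / ⟨x_0 - 1⟩` itself
this admits other models of the affine coordinate ring, such as `K[t]/(f)`. -/
structure IsDehomogenization {A : Type*} [CommRing A] [Algebra K A] (δ : X.coordRing →ₐ[K] A) :
    Prop where
  surjective : Function.Surjective δ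
  map_x_zero : δ (X.x 0) = 1
  eq_zero : ∀ (k : ℕ), ∀ f ∈ X.component k, δ f = 0 → f = 0

theorem isDehomogenization_deh (hX : X.AvoidsHyperplane) :
    X.IsDehomogenization (A := X.affineRing) X.deh where
  surjective := Ideal.Quotient.mk_surjective
  map_x_zero := X.deh_x_zero
  eq_zero _ _ hf h := eq_zero_of_deh_eq_zero hX hf h

variable (X) in
/-- The coordinate ring is nonzero, since its dimension is one. -/
theorem nontrivial_coordRing : Nontrivial X.coordRing := by
  rw [← not_subsingleton_iff_nontrivial]
  intro h
  have h1 := X.dim_eq_one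
  rw [ringKrullDim_eq_bot_of_subsingleton] at h1
  simp at h1

variable (X) in
/-- The affine coordinate ring is an algebra of finite type of dimension zero. -/
theorem finite_affineRing : Module.Finite K X.affineRing := by
  have h1 : Algebra.FiniteType K X.coordRing :=
    Algebra.FiniteType.of_surjective (Ideal.Quotient.mkₐ K X.ideal) Ideal.Quotient.mk_surjective
  have h2 : Algebra.FiniteType K X.affineRing :=
    Algebra.FiniteType.of_surjective (Ideal.Quotient.mkₐ K (Ideal.span {X.x 0 - 1}))
      Ideal.Quotient.mk_surjective
  refine (Module.finite_iff_krullDimLE_zero (R := K) (A := X.affineRing)).2 ?_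
  have h := ringKrullDim_quotient_succ_le_of_nonZeroDivisor X.x_zero_sub_one_mem_nonZeroDivisors
  rw [X.dim_eq_one] at h
  refine Ring.krullDimLE_iff.2 ?_
  have h' : ringKrullDim X.affineRing + 1 ≤ 0 + 1 := by simpa using h
  generalize ringKrullDim X.affineRing = d at h'
  induction d with
  | bot => exact bot_le
  | coe d =>
    have h2 : d + 1 ≤ 0 + 1 := by exact_mod_cast h'
    exact_mod_cast (ENat.add_le_add_iff_right ENat.one_ne_top).1 h2

namespace IsDehomogenization

variable {A : Type*} [CommRing A] [Algebra K A] {δ : X.coordRing →ₐ[K] A}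

theorem map_x_zero_mul (hδ : X.IsDehomogenization δ) (f : X.coordRing) :
    δ (X.x 0 * f) = δ f := by
  rw [map_mul, hδ.map_x_zero, one_mul]

theorem injOn_component (hδ : X.IsDehomogenization δ) (i : ℤ) :
    Set.InjOn δ (X.component i) := by
  rcases lt_or_ge i 0 with hi | hi
  · rw [X.component_of_neg hi]
    intro a ha b hb _
    rw [(Submodule.mem_bot K).1 ha, (Submodule.mem_bot K).1 hb]
  · lift i to ℕ using hi
    intro a ha b hb h
    exact sub_eq_zero.1 (hδ.eq_zero _ _ (sub_mem ha hb) (by rw [map_sub, h, sub_self]))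

theorem nontrivial (hδ : X.IsDehomogenization δ) : Nontrivial A :=
  have := X.nontrivial_coordRing
  ⟨1, 0, fun h => one_ne_zero (hδ.eq_zero 0 _ X.one_mem_component (by rw [map_one, h]))⟩

theorem gradedLift_x_zero (hδ : X.IsDehomogenization δ) :
    X.gradedLift δ (X.x 0) = Polynomial.X := by
  rw [X.gradedLift_of_mem (k := 1) δ (X.x_mem_component 0), hδ.map_x_zero,
    Polynomial.monomial_one_one_eq_X]

theorem gradedLift_injective (hδ : X.IsDehomogenization δ) :
    Function.Injective (X.gradedLift δ) := by
  rw [injective_iff_map_eq_zero]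
  intro f hf
  refine X.gradedLift_id_injective ?_
  rw [map_zero]
  ext k
  refine hδ.eq_zero _ _ (X.coeff_gradedLift_id_mem f k) ?_
  rw [← X.coeff_gradedLift δ f k, hf, Polynomial.coeff_zero]

/-! ### The Hilbert function of the coordinate ring -/

theorem map_component_mono (hδ : X.IsDehomogenization δ) :
    Monotone fun i => (X.component i).map δ.toLinearMap := by
  refine monotone_int_of_le_succ fun i => ?_
  rintro _ ⟨f, hf, rfl⟩
  refine ⟨f * X.x 0, X.mul_mem_component hf (X.x_mem_component 0), ?_⟩
  rw [mul_comm]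
  exact hδ.map_x_zero_mul f

theorem exists_mem_map_component (hδ : X.IsDehomogenization δ) (s : A) :
    ∃ k : ℕ, s ∈ (X.component k).map δ.toLinearMap := by
  obtain ⟨f, rfl⟩ := hδ.surjective s
  induction f using X.component_induction with
  | homogeneous k f hf => exact ⟨k, f, hf, rfl⟩
  | zero => exact ⟨0, by simp⟩
  | add f g hf hg =>
    obtain ⟨k, hk⟩ := hf
    obtain ⟨l, hl⟩ := hg
    refine ⟨max k l, ?_⟩
    rw [map_add]
    exact add_mem (hδ.map_component_mono (by simp) hk) (hδ.map_component_mono (by simp) hl)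

/-- Dehomogenization identifies `R_i` with a subspace of `A`. -/
theorem hilbertFunction_component (hδ : X.IsDehomogenization δ) (i : ℤ) :
    hilbertFunction K X.component i = Module.finrank K ((X.component i).map δ.toLinearMap) :=
  (LinearEquiv.ofBijective (δ.toLinearMap.submoduleMap (X.component i))
    ⟨fun a b h => Subtype.ext (hδ.injOn_component i a.2 b.2 (congrArg Subtype.val h)),
      LinearMap.submoduleMap_surjective _ _⟩).finrank_eq

variable [Module.Finite K A]

theorem finite_component (hδ : X.IsDehomogenization δ) (i : ℤ) :
    Module.Finite K (X.component i) :=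
  Module.Finite.of_injective (δ.toLinearMap.domRestrict (X.component i))
    fun a b h => Subtype.ext (hδ.injOn_component i a.2 b.2 h)

/-- The subspaces `δ(R_i)` form an ascending chain whose union is `A`. -/
theorem hasHilbertPolynomial_component (hδ : X.IsDehomogenization δ) :
    HasHilbertPolynomial (hilbertFunction K X.component) (Module.finrank K A) := by
  obtain ⟨m, hm⟩ := monotone_stabilizes_iff_noetherian.2 (inferInstance : IsNoetherian K A)
    ⟨fun k : ℕ => (X.component k).map δ.toLinearMap,
      fun a b h => hδ.map_component_mono (by exact_mod_cast h)⟩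
  refine eventually_atTop.2 ⟨m, fun i hi => ?_⟩
  have h : (X.component i).map δ.toLinearMap = ⊤ := ?_
  · rw [hδ.hilbertFunction_component, h, finrank_top]
  refine top_le_iff.1 fun s _ => hδ.map_component_mono hi ?_
  obtain ⟨k, hk⟩ := hδ.exists_mem_map_component s
  exact (hm (max m k) (le_max_left _ _)).ge (hδ.map_component_mono (by simp) hk)

theorem exists_isRegularityIndex (hδ : X.IsDehomogenization δ) :
    ∃ r, IsRegularityIndex (hilbertFunction K X.component) r := by
  have := hδ.nontrivial
  obtain ⟨m, hm⟩ := eventually_atTop.1 hδ.hasHilbertPolynomial_component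
  obtain ⟨r, -, hr⟩ := _root_.exists_isRegularityIndex
    (fun i hi => by rw [hilbertFunction, X.component_of_neg hi, finrank_bot])
    Module.finrank_pos.ne' hm
  exact ⟨r, hr⟩

variable {r : ℤ}

/-- From the regularity index on, every element of `A` is the dehomogenization of a homogeneous
element of the given degree. -/
theorem exists_mem_component (hδ : X.IsDehomogenization δ)
    (hr : IsRegularityIndex (hilbertFunction K X.component) r) {i : ℤ} (hi : r ≤ i)
    (s : A) : ∃ f ∈ X.component i, δ f = s := by
  have h : (X.component i).map δ.toLinearMap = ⊤ := by
    apply Submodule.eq_top_of_finrank_eq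
    rw [← hδ.hilbertFunction_component, hr.eq_of_le hδ.hasHilbertPolynomial_component hi]
  exact h.ge (Submodule.mem_top (x := s))

theorem regularityIndex_nonneg (hδ : X.IsDehomogenization δ)
    (hr : IsRegularityIndex (hilbertFunction K X.component) r) : 0 ≤ r := by
  have := hδ.nontrivial
  by_contra! h
  obtain ⟨f, hf, hf1⟩ := hδ.exists_mem_component hr (i := -1) (by omega) 1
  rw [X.component_of_neg (by norm_num), Submodule.mem_bot] at hf
  rw [hf, map_zero] at hf1
  exact zero_ne_one hf1

/-- Beyond the regularity index, `x_0` divides every homogeneous element. -/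
theorem exists_x_zero_mul_eq (hδ : X.IsDehomogenization δ)
    (hr : IsRegularityIndex (hilbertFunction K X.component) r) {i : ℤ} (hi : r ≤ i)
    {f : X.coordRing} (hf : f ∈ X.component (i + 1)) :
    ∃ g ∈ X.component i, X.x 0 * g = f := by
  obtain ⟨g, hg, hgf⟩ := hδ.exists_mem_component hr hi (δ f)
  refine ⟨g, hg, hδ.injOn_component (i + 1) ?_ hf ?_⟩
  · rw [mul_comm]; exact X.mul_mem_component hg (X.x_mem_component 0)
  · rw [hδ.map_x_zero_mul, hgf]

end IsDehomogenization

end ZeroDimSubscheme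

/-! ### The graded pieces of `A[X]` and of its Kähler differentials -/

/-- The component `A X^i` of degree `i` of `A[X]`. -/
def polynomialComponent (K A : Type*) [Field K] [CommRing A] [Algebra K A] (i : ℤ) :
    Submodule K A[X] :=
  Submodule.span K {F | ∃ (m : ℕ) (s : A), (m : ℤ) = i ∧ F = Polynomial.monomial m s}

/-- The component of degree `i` of `A[X] dX ⊕ (K[X] ⊗ Ω¹_{A/K})`, where `dX` has degree one. -/
def polynomialKaehlerComponent (K A : Type*) [Field K] [CommRing A] [Algebra K A] (i : ℤ) :
    Submodule K (A[X] × (K[X] ⊗[K] Ω[A⁄K])) :=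
  Submodule.span K
    ({w | ∃ (m : ℕ) (s : A), (m : ℤ) + 1 = i ∧ w = (Polynomial.monomial m s, 0)} ∪
      {w | ∃ (m : ℕ) (η : Ω[A⁄K]), (m : ℤ) = i ∧ w = (0, (Polynomial.X ^ m : K[X]) ⊗ₜ[K] η)})

theorem finrank_polynomialKaehlerComponent (K A : Type*) [Field K] [CommRing A] [Algebra K A]
    [Module.Finite K A] [Module.Finite K (Ω[A⁄K])] {i : ℤ} (hi : 1 ≤ i) :
    Module.finrank K (polynomialKaehlerComponent K A i) =
      Module.finrank K A + Module.finrank K (Ω[A⁄K]) := by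
  obtain ⟨m, rfl⟩ : ∃ m : ℕ, (m : ℤ) + 1 = i := ⟨(i - 1).toNat, by omega⟩
  let φ : A × Ω[A⁄K] →ₗ[K] A[X] × (K[X] ⊗[K] Ω[A⁄K]) :=
    LinearMap.prodMap ((Polynomial.monomial m : A →ₗ[A] A[X]).restrictScalars K)
      ((polynomialModuleEquivTensor K A (Ω[A⁄K])).toLinearMap ∘ₗ
        (PolynomialModule.lsingle A (m + 1) : Ω[A⁄K] →ₗ[A] _).restrictScalars K)
  have hφ : ∀ s η, φ (s, η) =
      (Polynomial.monomial m s, (Polynomial.X ^ (m + 1) : K[X]) ⊗ₜ[K] η) := fun s η =>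
    Prod.ext rfl (polynomialModuleEquivTensor_single K A (Ω[A⁄K]) (m + 1) η)
  have hinj : Function.Injective φ := by
    rintro ⟨s, η⟩ ⟨s', η'⟩ h
    have h1 : Polynomial.monomial m s = Polynomial.monomial m s' := congrArg Prod.fst h
    have h2 : PolynomialModule.lsingle A (m + 1) η = PolynomialModule.lsingle A (m + 1) η' :=
      (polynomialModuleEquivTensor K A (Ω[A⁄K])).injective (congrArg Prod.snd h)
    have h3 := congrArg (fun q => q.coeff (m + 1)) h2
    rw [Polynomial.monomial_injective m h1]
    simpa [PolynomialModule.lsingle_apply] using h3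
  have hrange : LinearMap.range φ = polynomialKaehlerComponent K A (m + 1) := by
    apply le_antisymm
    · rintro _ ⟨⟨s, η⟩, rfl⟩
      have h : φ (s, η) = (Polynomial.monomial m s, 0) +
          (0, (Polynomial.X ^ (m + 1) : K[X]) ⊗ₜ[K] η) := by rw [hφ]; simp
      rw [h]
      exact add_mem (Submodule.subset_span (Or.inl ⟨m, s, rfl, rfl⟩))
        (Submodule.subset_span (Or.inr ⟨m + 1, η, by push_cast; rfl, rfl⟩))
    · refine Submodule.span_le.2 ?_
      rintro _ (⟨k, s, hk, rfl⟩ | ⟨k, η, hk, rfl⟩)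
      · obtain rfl : k = m := by omega
        exact ⟨(s, 0), by rw [hφ, TensorProduct.tmul_zero]⟩
      · obtain rfl : k = m + 1 := by omega
        exact ⟨(0, η), by rw [hφ, map_zero]⟩
  rw [← hrange, LinearMap.finrank_range_of_inj hinj, Module.finrank_prod]

namespace ZeroDimSubscheme.IsDehomogenization

variable {K : Type u} [Field K] {n : ℕ} {X : ZeroDimSubscheme K n}
variable {A : Type*} [CommRing A] [Algebra K A] {δ : X.coordRing →ₐ[K] A}

/-! ### The homogeneous ring of quotients -/

theorem avoidsHyperplane (hδ : X.IsDehomogenization δ) : X.AvoidsHyperplane := by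
  refine mem_nonZeroDivisors_iff_right.2 fun f hf => hδ.gradedLift_injective ?_
  have h := congrArg (X.gradedLift δ) hf
  rw [map_mul, hδ.gradedLift_x_zero, map_zero] at h
  rw [map_zero]
  exact Polynomial.isRegular_X.right (h.trans (zero_mul _).symm)

variable (X) in
/-- A homogeneous non-zerodivisor has a natural number as its degree, as it is not zero. -/
theorem _root_.ZeroDimSubscheme.exists_natCast_mem_component
    (b : X.homogeneousNonZeroDivisors) : ∃ j : ℕ, (b : X.coordRing) ∈ X.component j := by
  have := X.nontrivial_coordRing
  obtain ⟨hb, i, hi⟩ := b.2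
  rcases lt_or_ge i 0 with h | h
  · rw [X.component_of_neg h, Submodule.mem_bot] at hi
    exact absurd hi (nonZeroDivisors.ne_zero hb)
  · exact ⟨i.toNat, by rwa [Int.toNat_of_nonneg h]⟩

section Unit

variable [Module.Finite K A]

/-- As `A` is a finite dimensional algebra, it suffices that `δ b` is a non-zerodivisor. -/
theorem isUnit_map (hδ : X.IsDehomogenization δ) (b : X.homogeneousNonZeroDivisors) :
    IsUnit (δ b) := by
  have : IsArtinianRing A := IsArtinianRing.of_finite K A
  refine IsArtinianRing.isUnit_of_mem_nonZeroDivisors (mem_nonZeroDivisors_iff_right.2 ?_)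
  intro s hs
  obtain ⟨k, f, hf, rfl⟩ := hδ.exists_mem_map_component s
  obtain ⟨j, hj⟩ := X.exists_natCast_mem_component b
  have h := hδ.eq_zero (k + j) (f * b)
    (by rw [Nat.cast_add]; exact X.mul_mem_component hf hj) ((map_mul δ f b).trans hs)
  rw [(mul_right_mem_nonZeroDivisors_eq_zero_iff b.2.1).1 h, map_zero]

/-- The homomorphism `Q^h(R) → A[T, T⁻¹]` that sends `a / b` to
`δ(a) δ(b)⁻¹ T^(deg a - deg b)`. -/
def toLaurent (hδ : X.IsDehomogenization δ) : X.quotientRing →ₐ[K] LaurentPolynomial A :=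
  IsLocalization.liftAlgHom (M := X.homogeneousNonZeroDivisors)
    (f := ((Polynomial.toLaurentAlg (R := A)).restrictScalars K).comp (X.gradedLift δ)) (by
      intro b
      obtain ⟨j, hj⟩ := X.exists_natCast_mem_component b
      simp only [AlgHom.comp_apply, AlgHom.restrictScalars_apply, X.gradedLift_of_mem δ hj,
        Polynomial.toLaurentAlg_apply, ← Polynomial.C_mul_X_pow_eq_monomial,
        Polynomial.toLaurent_C_mul_X_pow]
      exact ((hδ.isUnit_map b).map LaurentPolynomial.C).mul (LaurentPolynomial.isUnit_T _))

theorem toLaurent_algebraMap (hδ : X.IsDehomogenization δ) (f : X.coordRing) :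
    hδ.toLaurent (algebraMap X.coordRing X.quotientRing f) =
      Polynomial.toLaurent (X.gradedLift δ f) :=
  IsLocalization.lift_eq _ f

theorem toLaurent_algebraMap_of_mem (hδ : X.IsDehomogenization δ) {k : ℕ} {f : X.coordRing}
    (hf : f ∈ X.component k) :
    hδ.toLaurent (algebraMap X.coordRing X.quotientRing f) =
      LaurentPolynomial.C (δ f) * LaurentPolynomial.T k := by
  rw [hδ.toLaurent_algebraMap, X.gradedLift_of_mem δ hf, ← Polynomial.C_mul_X_pow_eq_monomial,
    Polynomial.toLaurent_C_mul_X_pow]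

theorem toLaurent_injective (hδ : X.IsDehomogenization δ) : Function.Injective hδ.toLaurent := by
  rw [injective_iff_map_eq_zero]
  intro q hq
  obtain ⟨a, b, rfl⟩ := IsLocalization.exists_mk'_eq X.homogeneousNonZeroDivisors q
  have h := congrArg hδ.toLaurent (IsLocalization.mk'_spec X.quotientRing a b)
  rw [map_mul, hq, zero_mul, hδ.toLaurent_algebraMap] at h
  have ha : a = 0 := hδ.gradedLift_injective (Polynomial.toLaurent_injective (by
    rw [← h, map_zero, map_zero]))
  rw [ha, IsLocalization.mk'_zero]

theorem toLaurent_mk' (hδ : X.IsDehomogenization δ) {i j : ℕ} {a : X.coordRing}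
    {b : X.homogeneousNonZeroDivisors} (ha : a ∈ X.component i)
    (hb : (b : X.coordRing) ∈ X.component j) {s : A} (hs : s * δ b = δ a) :
    hδ.toLaurent (IsLocalization.mk' X.quotientRing a b) =
      LaurentPolynomial.C s * LaurentPolynomial.T ((i : ℤ) - j) := by
  have hu : IsUnit (hδ.toLaurent (algebraMap X.coordRing X.quotientRing b)) :=
    (IsLocalization.map_units X.quotientRing b).map hδ.toLaurent
  refine hu.mul_right_cancel ?_
  rw [← map_mul, IsLocalization.mk'_spec, hδ.toLaurent_algebraMap_of_mem ha,
    hδ.toLaurent_algebraMap_of_mem hb, ← hs, map_mul, mul_mul_mul_comm,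
    ← LaurentPolynomial.T_add, sub_add_cancel]

theorem exists_toLaurent_eq (hδ : X.IsDehomogenization δ) {d : ℤ} {q : X.quotientRing}
    (hq : q ∈ X.quotientComponent d) :
    ∃ s, hδ.toLaurent q = LaurentPolynomial.C s * LaurentPolynomial.T d := by
  induction hq using Submodule.span_induction with
  | mem q hq =>
    obtain ⟨i, j, a, b, ha, hb, rfl, rfl⟩ := hq
    have := X.nontrivial_coordRing
    have hj : 0 ≤ j := by
      by_contra! h
      rw [X.component_of_neg h, Submodule.mem_bot] at hb
      exact nonZeroDivisors.ne_zero b.2.1 hb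
    rcases lt_or_ge i 0 with hi | hi
    · rw [X.component_of_neg hi, Submodule.mem_bot] at ha
      refine ⟨0, ?_⟩
      rw [ha, IsLocalization.mk'_zero, map_zero, map_zero, zero_mul]
    · lift i to ℕ using hi
      lift j to ℕ using hj
      obtain ⟨v, hv⟩ := (hδ.isUnit_map b).exists_left_inv
      exact ⟨δ a * v, hδ.toLaurent_mk' ha hb (by rw [mul_assoc, hv, mul_one])⟩
  | zero => exact ⟨0, by simp⟩
  | add p q _ _ hp hq =>
    obtain ⟨s, hs⟩ := hp
    obtain ⟨t, ht⟩ := hq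
    exact ⟨s + t, by rw [map_add, hs, ht, map_add, add_mul]⟩
  | smul c q _ hq =>
    obtain ⟨s, hs⟩ := hq
    refine ⟨c • s, ?_⟩
    rw [map_smul, hs, Algebra.smul_def c s, map_mul, mul_assoc, Algebra.smul_def]
    rfl

/-- An element of `A T^d` is of the form `δ(f) T^d` with `f` homogeneous of large degree `k`, and
it is then the image of `f / x_0^(k - d)`. -/
theorem exists_mem_quotientComponent (hδ : X.IsDehomogenization δ) (d : ℤ) (s : A) :
    ∃ q ∈ X.quotientComponent d,
      hδ.toLaurent q = LaurentPolynomial.C s * LaurentPolynomial.T d := by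
  obtain ⟨k, hk⟩ := hδ.exists_mem_map_component s
  obtain ⟨f, hf, rfl⟩ := hδ.map_component_mono (le_max_left (k : ℤ) d.toNat) hk
  rw [← Nat.cast_max] at hf
  set k' := max k d.toNat
  obtain ⟨j, hj⟩ : ∃ j : ℕ, (k' : ℤ) - j = d := ⟨(k' - d).toNat, by omega⟩
  have hx : X.x 0 ^ j ∈ X.component j := by
    have := X.mk_mem_component (MvPolynomial.isHomogeneous_X_pow (R := K) (0 : Fin (n + 1)) j)
    rwa [map_pow] at this
  let b : X.homogeneousNonZeroDivisors := ⟨X.x 0 ^ j, pow_mem hδ.avoidsHyperplane j, j, hx⟩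
  refine ⟨IsLocalization.mk' X.quotientRing f b,
    Submodule.subset_span ⟨k', j, f, b, hf, hx, hj, rfl⟩, ?_⟩
  rw [hδ.toLaurent_mk' hf (b := b) hx (s := δ f), hj]
  · rfl
  · change δ f * δ (X.x 0 ^ j) = δ f
    rw [map_pow, hδ.map_x_zero, one_pow, mul_one]

theorem mem_quotientComponent_iff (hδ : X.IsDehomogenization δ) {d : ℤ} {q : X.quotientRing} :
    q ∈ X.quotientComponent d ↔
      ∃ s, hδ.toLaurent q = LaurentPolynomial.C s * LaurentPolynomial.T d := by
  refine ⟨hδ.exists_toLaurent_eq, ?_⟩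
  rintro ⟨s, hs⟩
  obtain ⟨q', hq', h⟩ := hδ.exists_mem_quotientComponent d s
  rwa [hδ.toLaurent_injective (hs.trans h.symm)]

/-! ### The truncated integral closure -/

theorem exists_mem_truncSubalgebra (hδ : X.IsDehomogenization δ) (F : A[X]) :
    ∃ q ∈ X.truncSubalgebra, hδ.toLaurent q = Polynomial.toLaurent F := by
  induction F using Polynomial.induction_on' with
  | add F G hF hG =>
    obtain ⟨p, hp, hpF⟩ := hF
    obtain ⟨q, hq, hqG⟩ := hG
    exact ⟨p + q, add_mem hp hq, by rw [map_add, hpF, hqG, map_add]⟩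
  | monomial m s =>
    obtain ⟨q, hq, hqs⟩ := hδ.exists_mem_quotientComponent m s
    refine ⟨q, Algebra.subset_adjoin ⟨m, Int.natCast_nonneg m, hq⟩, ?_⟩
    rw [hqs, ← Polynomial.C_mul_X_pow_eq_monomial, Polynomial.toLaurent_C_mul_X_pow]

theorem exists_toLaurent_eq_toLaurent (hδ : X.IsDehomogenization δ) {q : X.quotientRing}
    (hq : q ∈ X.truncSubalgebra) : ∃ F : A[X], Polynomial.toLaurent F = hδ.toLaurent q := by
  have h : X.truncSubalgebra ≤
      (((Polynomial.toLaurentAlg (R := A)).restrictScalars K).range).comap hδ.toLaurent := by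
    refine Algebra.adjoin_le ?_
    rintro q ⟨d, hd, hq⟩
    lift d to ℕ using hd
    obtain ⟨s, hs⟩ := hδ.exists_toLaurent_eq hq
    refine ⟨Polynomial.C s * Polynomial.X ^ d, ?_⟩
    exact (Polynomial.toLaurent_C_mul_X_pow d s).trans hs.symm
  exact h hq

/-- Inside `A[T, T⁻¹]`, the truncated integral closure is `A[T]`. -/
theorem exists_algEquiv_truncClosure (hδ : X.IsDehomogenization δ) :
    ∃ θ : X.truncClosure ≃ₐ[K] A[X], ∀ q : X.truncClosure,
      Polynomial.toLaurent (θ q) = hδ.toLaurent (q : X.quotientRing) := by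
  let ι : A[X] →ₐ[K] LaurentPolynomial A := (Polynomial.toLaurentAlg (R := A)).restrictScalars K
  have hι : Function.Injective ι := Polynomial.toLaurent_injective
  let j : A[X] ≃ₐ[K] ι.range := AlgEquiv.ofInjective ι hι
  let φ : X.truncClosure →ₐ[K] ι.range :=
    (hδ.toLaurent.comp X.truncSubalgebra.val).codRestrict ι.range fun q =>
      hδ.exists_toLaurent_eq_toLaurent q.2
  have hφ : Function.Bijective φ := by
    constructor
    · intro p q h
      exact Subtype.ext (hδ.toLaurent_injective (congrArg Subtype.val h))
    · rintro ⟨_, F, rfl⟩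
      obtain ⟨q, hq, hqF⟩ := hδ.exists_mem_truncSubalgebra F
      exact ⟨⟨q, hq⟩, Subtype.ext hqF⟩
  refine ⟨(AlgEquiv.ofBijective φ hφ).trans j.symm, fun q => ?_⟩
  have h : j (j.symm (φ q)) = φ q := j.apply_symm_apply _
  exact congrArg Subtype.val h

/-- The isomorphism of the truncated integral closure with `A[X]` that sends a homogeneous
element `f` of degree `k` of `R` to `δ(f) X^k`. -/
def truncEquiv (hδ : X.IsDehomogenization δ) : X.truncClosure ≃ₐ[K] A[X] :=
  hδ.exists_algEquiv_truncClosure.choose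

theorem toLaurent_truncEquiv (hδ : X.IsDehomogenization δ) (q : X.truncClosure) :
    Polynomial.toLaurent (hδ.truncEquiv q) = hδ.toLaurent (q : X.quotientRing) :=
  hδ.exists_algEquiv_truncClosure.choose_spec q

theorem truncEquiv_incl (hδ : X.IsDehomogenization δ) (f : X.coordRing) :
    hδ.truncEquiv (X.incl f) = X.gradedLift δ f :=
  Polynomial.toLaurent_injective ((hδ.toLaurent_truncEquiv _).trans (hδ.toLaurent_algebraMap f))

theorem truncEquiv_incl_of_mem (hδ : X.IsDehomogenization δ) {k : ℕ} {f : X.coordRing}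
    (hf : f ∈ X.component k) : hδ.truncEquiv (X.incl f) = Polynomial.monomial k (δ f) := by
  rw [hδ.truncEquiv_incl, X.gradedLift_of_mem δ hf]

theorem truncEquiv_incl_x_zero (hδ : X.IsDehomogenization δ) :
    hδ.truncEquiv (X.incl (X.x 0)) = Polynomial.X := by
  rw [hδ.truncEquiv_incl, hδ.gradedLift_x_zero]

theorem incl_injective (hδ : X.IsDehomogenization δ) : Function.Injective X.incl := by
  intro f g h
  apply hδ.gradedLift_injective
  rw [← hδ.truncEquiv_incl, ← hδ.truncEquiv_incl, h]

theorem mem_truncComponent_natCast_iff (hδ : X.IsDehomogenization δ) {m : ℕ}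
    {q : X.truncClosure} :
    q ∈ X.truncComponent m ↔ ∃ s, hδ.truncEquiv q = Polynomial.monomial m s := by
  refine (hδ.mem_quotientComponent_iff (q := (q : X.quotientRing))).trans
    (exists_congr fun s => ?_)
  rw [← hδ.toLaurent_truncEquiv, ← Polynomial.toLaurent_C_mul_X_pow,
    Polynomial.C_mul_X_pow_eq_monomial, Polynomial.toLaurent_inj]

theorem eq_zero_of_mem_truncComponent (hδ : X.IsDehomogenization δ) {d : ℤ} (hd : d < 0)
    {q : X.truncClosure} (hq : q ∈ X.truncComponent d) : q = 0 := by
  obtain ⟨s, hs⟩ := hδ.mem_quotientComponent_iff.1 (show (q : X.quotientRing) ∈ _ from hq)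
  rw [← hδ.toLaurent_truncEquiv] at hs
  have h : hδ.truncEquiv q = 0 := by
    rw [← Polynomial.trunc_toLaurent (hδ.truncEquiv q), hs, LaurentPolynomial.trunc_C_mul_T,
      if_neg (not_le.2 hd)]
  exact (map_eq_zero_iff _ hδ.truncEquiv.injective).1 h

theorem map_truncComponent (hδ : X.IsDehomogenization δ) (i : ℤ) :
    (X.truncComponent i).map hδ.truncEquiv.toLinearMap = polynomialComponent K A i := by
  apply le_antisymm
  · rintro _ ⟨q, hq, rfl⟩
    rcases lt_or_ge i 0 with hi | hi
    · rw [hδ.eq_zero_of_mem_truncComponent hi hq, map_zero]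
      exact zero_mem _
    · lift i to ℕ using hi
      obtain ⟨s, hs⟩ := hδ.mem_truncComponent_natCast_iff.1 hq
      exact Submodule.subset_span ⟨i, s, rfl, hs⟩
  · refine Submodule.span_le.2 ?_
    rintro _ ⟨m, s, rfl, rfl⟩
    exact ⟨hδ.truncEquiv.symm (Polynomial.monomial m s),
      hδ.mem_truncComponent_natCast_iff.2 ⟨s, hδ.truncEquiv.apply_symm_apply _⟩,
      hδ.truncEquiv.apply_symm_apply _⟩

end Unit

end ZeroDimSubscheme.IsDehomogenization

namespace ZeroDimSubscheme

variable {K : Type u} [Field K] {n : ℕ} (X : ZeroDimSubscheme K n)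

open KaehlerDifferential

/-! ### Kähler differentials of the truncated integral closure -/

theorem Phi_smul_D (f g : X.coordRing) :
    X.Phi (f • D K X.coordRing g) = X.incl f • D K X.truncClosure (X.incl g) := by
  have h : X.Phi (D K X.coordRing g) = D K X.truncClosure (X.incl g) :=
    KaehlerDifferential.map_D K K X.coordRing X.truncClosure g
  rw [map_smul, h]
  exact algebra_compatible_smul X.truncClosure f (D K X.truncClosure (X.incl g))

theorem Phi_smul (f : X.coordRing) (w : Ω[X.coordRing⁄K]) :
    X.Phi (f • w) = X.incl f • X.Phi w := by
  rw [map_smul]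
  exact algebra_compatible_smul X.truncClosure f (X.Phi w)

theorem incl_mem_truncComponent {i : ℤ} {f : X.coordRing} (hf : f ∈ X.component i) :
    X.incl f ∈ X.truncComponent i :=
  Submodule.subset_span ⟨i, 0, f, 1, hf, X.one_mem_component, sub_zero i,
    (IsLocalization.mk'_one X.quotientRing f).symm⟩

theorem mapsTo_Phi (i : ℤ) : Set.MapsTo X.Phi (kaehlerComponent K X.component i)
    (kaehlerComponent K X.truncComponent i) := by
  intro w hw
  induction hw using Submodule.span_induction with
  | mem w hw =>
    obtain ⟨a, b, hab, f, hf, g, hg, rfl⟩ := hw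
    rw [Phi_smul_D]
    exact Submodule.subset_span ⟨a, b, hab, _, X.incl_mem_truncComponent hf, _,
      X.incl_mem_truncComponent hg, rfl⟩
  | zero => rw [map_zero]; exact zero_mem _
  | add v w _ _ hv hw => rw [map_add]; exact add_mem hv hw
  | smul c w _ hw =>
    have h : X.Phi (c • w) = c • X.Phi w := LinearMap.map_smul_of_tower X.Phi c w
    rw [h]
    exact Submodule.smul_mem _ c hw

namespace IsDehomogenization

variable {X} {A : Type*} [CommRing A] [Algebra K A] [Module.Finite K A]
  {δ : X.coordRing →ₐ[K] A}

/-- The isomorphism of `Ω¹` of the truncated integral closure with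
`A[X] dX ⊕ (K[X] ⊗ Ω¹_{A/K})`. -/
def splitEquiv (hδ : X.IsDehomogenization δ) :
    Ω[X.truncClosure⁄K] ≃ₗ[K] A[X] × (K[X] ⊗[K] Ω[A⁄K]) :=
  (kaehlerCongr hδ.truncEquiv).trans
    (((polynomialKaehlerEquiv K A).restrictScalars K).trans
      (LinearEquiv.prodCongr (LinearEquiv.refl K A[X]) (polynomialModuleEquivTensor K A (Ω[A⁄K]))))

theorem splitEquiv_apply (hδ : X.IsDehomogenization δ) (w : Ω[X.truncClosure⁄K]) :
    hδ.splitEquiv w = ((polynomialKaehlerEquiv K A (kaehlerCongr hδ.truncEquiv w)).1,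
      polynomialModuleEquivTensor K A (Ω[A⁄K])
        (polynomialKaehlerEquiv K A (kaehlerCongr hδ.truncEquiv w)).2) := rfl

theorem splitEquiv_x_zero_smul (hδ : X.IsDehomogenization δ) (w : Ω[X.truncClosure⁄K]) :
    hδ.splitEquiv (X.incl (X.x 0) • w) =
      (Polynomial.X * (hδ.splitEquiv w).1, (Polynomial.X : K[X]) • (hδ.splitEquiv w).2) := by
  rw [splitEquiv_apply, splitEquiv_apply, kaehlerCongr_smul, hδ.truncEquiv_incl_x_zero, map_smul]
  ext : 1
  · rfl
  · exact polynomialModuleEquivTensor_X_smul K A (Ω[A⁄K]) _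

theorem splitEquiv_smul_D_x_zero (hδ : X.IsDehomogenization δ) (F : A[X]) :
    hδ.splitEquiv (hδ.truncEquiv.symm F • D K X.truncClosure (X.incl (X.x 0))) = (F, 0) := by
  rw [splitEquiv_apply, kaehlerCongr_smul, kaehlerCongr_D, hδ.truncEquiv_incl_x_zero, map_smul,
    AlgEquiv.apply_symm_apply, polynomialKaehlerEquiv_D]
  ext : 1
  · simp
  · simp

/-- The value on `f dg` for homogeneous elements `f = s X^m` and `g = t X^k`. -/
theorem splitEquiv_smul_D (hδ : X.IsDehomogenization δ) {m k : ℕ} {s t : A}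
    {f g : X.truncClosure} (hf : hδ.truncEquiv f = Polynomial.monomial m s)
    (hg : hδ.truncEquiv g = Polynomial.monomial k t) :
    hδ.splitEquiv (f • D K X.truncClosure g) =
      (Polynomial.monomial (m + (k - 1)) (s * (t * k)),
        (Polynomial.X ^ (m + k) : K[X]) ⊗ₜ[K] (s • D K A t)) := by
  rw [splitEquiv_apply, kaehlerCongr_smul, kaehlerCongr_D, hf, hg, map_smul,
    polynomialKaehlerEquiv_D]
  ext : 1
  · simp [Polynomial.derivative_monomial, Polynomial.monomial_mul_monomial]
  · simp [polynomialModuleEquivTensor_single]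

theorem splitEquiv_Phi (hδ : X.IsDehomogenization δ) {k : ℕ} {f : X.coordRing}
    (hf : f ∈ X.component k) (i : Fin (n + 1)) :
    hδ.splitEquiv (X.Phi (f • D K X.coordRing (X.x i))) =
      (Polynomial.monomial k (δ f * δ (X.x i)),
        (Polynomial.X ^ (k + 1) : K[X]) ⊗ₜ[K] (δ f • D K A (δ (X.x i)))) := by
  rw [Phi_smul_D, hδ.splitEquiv_smul_D (hδ.truncEquiv_incl_of_mem hf)
    (hδ.truncEquiv_incl_of_mem (k := 1) (X.x_mem_component i))]
  simp

theorem splitEquiv_Phi_x_zero (hδ : X.IsDehomogenization δ) {k : ℕ} {f : X.coordRing}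
    (hf : f ∈ X.component k) :
    hδ.splitEquiv (X.Phi (f • D K X.coordRing (X.x 0))) = (Polynomial.monomial k (δ f), 0) := by
  rw [hδ.splitEquiv_Phi hf, hδ.map_x_zero]
  simp

theorem splitEquiv_symm_monomial_smul_D (hδ : X.IsDehomogenization δ) (m : ℕ) (s t : A) :
    hδ.splitEquiv (hδ.truncEquiv.symm (Polynomial.monomial m s) •
        D K X.truncClosure (hδ.truncEquiv.symm (Polynomial.C t))) =
      (0, (Polynomial.X ^ m : K[X]) ⊗ₜ[K] (s • D K A t)) := by
  rw [← Polynomial.monomial_zero_left, hδ.splitEquiv_smul_D (hδ.truncEquiv.apply_symm_apply _)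
    (hδ.truncEquiv.apply_symm_apply _)]
  simp

theorem symm_monomial_mem_truncComponent (hδ : X.IsDehomogenization δ) (m : ℕ) (s : A) :
    hδ.truncEquiv.symm (Polynomial.monomial m s) ∈ X.truncComponent m :=
  hδ.mem_truncComponent_natCast_iff.2 ⟨s, hδ.truncEquiv.apply_symm_apply _⟩

theorem map_kaehlerComponent (hδ : X.IsDehomogenization δ) (i : ℤ) :
    (kaehlerComponent K X.truncComponent i).map hδ.splitEquiv.toLinearMap =
      polynomialKaehlerComponent K A i := by
  apply le_antisymm
  · refine Submodule.map_le_iff_le_comap.2 (Submodule.span_le.2 ?_)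
    rintro _ ⟨a, b, rfl, f, hf, g, hg, rfl⟩
    change hδ.splitEquiv _ ∈ polynomialKaehlerComponent K A (a + b)
    rcases lt_or_ge a 0 with ha | ha
    · rw [hδ.eq_zero_of_mem_truncComponent ha hf, zero_smul, map_zero]
      exact zero_mem _
    rcases lt_or_ge b 0 with hb | hb
    · rw [hδ.eq_zero_of_mem_truncComponent hb hg, map_zero, smul_zero, map_zero]
      exact zero_mem _
    lift a to ℕ using ha
    lift b to ℕ using hb
    obtain ⟨s, hs⟩ := hδ.mem_truncComponent_natCast_iff.1 hf
    obtain ⟨t, ht⟩ := hδ.mem_truncComponent_natCast_iff.1 hg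
    rw [hδ.splitEquiv_smul_D hs ht, ← add_zero (Polynomial.monomial _ _),
      ← zero_add (_ ⊗ₜ[K] _), ← Prod.mk_add_mk]
    refine add_mem ?_ (Submodule.subset_span (Or.inr ⟨a + b, _, by push_cast; rfl, rfl⟩))
    rcases b with _ | b
    · simp only [Nat.cast_zero, mul_zero, map_zero]
      exact zero_mem _
    · exact Submodule.subset_span (Or.inl ⟨a + b, _, by push_cast; ring, rfl⟩)
  · refine Submodule.span_le.2 ?_
    rintro _ (⟨m, s, rfl, rfl⟩ | ⟨m, η, rfl, rfl⟩)
    · exact ⟨_, Submodule.subset_span ⟨m, 1, rfl, _, hδ.symm_monomial_mem_truncComponent m s, _,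
        X.incl_mem_truncComponent (X.x_mem_component 0), rfl⟩, hδ.splitEquiv_smul_D_x_zero _⟩
    · induction η using kaehlerDifferential_induction with
      | zero => rw [TensorProduct.tmul_zero]; exact zero_mem _
      | add η ζ hη hζ =>
        rw [TensorProduct.tmul_add, ← add_zero (0 : A[X]), ← Prod.mk_add_mk]
        exact add_mem hη hζ
      | smul_D s t =>
        exact ⟨_, Submodule.subset_span ⟨m, (0 : ℕ), by simp, _,
          hδ.symm_monomial_mem_truncComponent m s, _, hδ.symm_monomial_mem_truncComponent 0 t,
          rfl⟩, hδ.splitEquiv_symm_monomial_smul_D m s t⟩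

theorem finrank_kaehlerComponent_truncComponent (hδ : X.IsDehomogenization δ) {i : ℤ}
    (hi : 1 ≤ i) :
    Module.finrank K (kaehlerComponent K X.truncComponent i) =
      Module.finrank K A + Module.finrank K (Ω[A⁄K]) := by
  have : Module.Finite K (Ω[A⁄K]) := finite_kaehlerDifferential K A
  rw [← finrank_polynomialKaehlerComponent K A hi, ← hδ.map_kaehlerComponent]
  exact (hδ.splitEquiv.submoduleMap _).finrank_eq

theorem finite_kaehlerComponent_truncComponent (hδ : X.IsDehomogenization δ) {i : ℤ}
    (hi : 1 ≤ i) : Module.Finite K (kaehlerComponent K X.truncComponent i) := by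
  have := hδ.nontrivial
  refine Module.finite_of_finrank_pos ?_
  rw [hδ.finrank_kaehlerComponent_truncComponent hi]
  exact Nat.add_pos_left Module.finrank_pos _

/-! ### The kernel of `Φ` -/

/-- Homogeneous non-zerodivisors `b` of `R` act injectively on `Ω¹` of the truncated integral
closure, because they correspond to elements `u X^j` with a unit `u`. -/
theorem eq_zero_of_incl_smul_eq_zero (hδ : X.IsDehomogenization δ)
    (b : X.homogeneousNonZeroDivisors) {w : Ω[X.truncClosure⁄K]}
    (hw : X.incl (b : X.coordRing) • w = 0) : w = 0 := by
  obtain ⟨j, hj⟩ := X.exists_natCast_mem_component b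
  have h : Polynomial.monomial j (δ b) •
      polynomialKaehlerEquiv K A (kaehlerCongr hδ.truncEquiv w) = 0 := by
    rw [← hδ.truncEquiv_incl_of_mem hj, ← map_smul, ← kaehlerCongr_smul, hw, map_zero, map_zero]
  rw [← map_eq_zero_iff _ (kaehlerCongr hδ.truncEquiv).injective,
    ← map_eq_zero_iff _ (polynomialKaehlerEquiv K A).injective]
  have hu := hδ.isUnit_map b
  generalize polynomialKaehlerEquiv K A (kaehlerCongr hδ.truncEquiv w) = v at h
  obtain ⟨F, q⟩ := v
  have hF : Polynomial.monomial j (δ b) * F = 0 := congrArg Prod.fst h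
  have hq : Polynomial.monomial j (δ b) • q = 0 := congrArg Prod.snd h
  refine Prod.ext (Polynomial.ext fun k => ?_) (PolynomialModule.ext (Finsupp.ext fun k => ?_))
  · have h1 := congrArg (fun p => p.coeff (k + j)) hF
    rw [Polynomial.coeff_monomial_mul] at h1
    exact (hu.mul_right_eq_zero).1 h1
  · have h1 := congrArg (fun p => p.coeff (j + k)) hq
    simp only [PolynomialModule.monomial_smul_apply, if_pos (Nat.le_add_right j k),
      Nat.add_sub_cancel_left] at h1
    exact (hu.smul_eq_zero).1 h1

theorem ker_Phi (hδ : X.IsDehomogenization δ) : LinearMap.ker X.Phi = X.torsionKaehler := by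
  ext w
  rw [LinearMap.mem_ker, torsionKaehler, Submodule.mem_torsion'_iff]
  constructor
  · intro hw
    have : IsScalarTower X.coordRing X.truncClosure X.quotientRing :=
      IsScalarTower.of_algebraMap_eq fun f => rfl
    have : IsScalarTower K X.truncClosure X.quotientRing :=
      IsScalarTower.of_algebraMap_eq fun f => rfl
    -- `Q^h(R)` is a localization, so that its module of differentials is the localization of
    -- that of `R`; and the map from the latter factors through `Φ`.
    have h : KaehlerDifferential.map K K X.coordRing X.quotientRing w = 0 :=
      (KaehlerDifferential.map_map_apply (B := X.truncClosure) w).symm.trans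
        ((congrArg (KaehlerDifferential.map K K X.truncClosure X.quotientRing) hw).trans
          (map_zero _))
    exact (IsLocalizedModule.eq_zero_iff X.homogeneousNonZeroDivisors
      (KaehlerDifferential.map K K X.coordRing X.quotientRing)).1 h
  · rintro ⟨b, hb⟩
    refine hδ.eq_zero_of_incl_smul_eq_zero b ?_
    rw [← Phi_smul]
    exact (congrArg X.Phi hb).trans (map_zero _)

/-- Every torsion element is annihilated by a power of `x_0`, as every homogeneous
non-zerodivisor divides a power of `x_0`. -/
theorem exists_x_zero_pow_smul_eq_zero (hδ : X.IsDehomogenization δ) {w : Ω[X.coordRing⁄K]}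
    (hw : X.Phi w = 0) : ∃ N : ℕ, X.x 0 ^ N • w = 0 := by
  have hw' : w ∈ X.torsionKaehler := hδ.ker_Phi ▸ hw
  obtain ⟨b, hb⟩ := (Submodule.mem_torsion'_iff _ w).1 hw'
  obtain ⟨j, hj⟩ := X.exists_natCast_mem_component b
  obtain ⟨v, hv⟩ := (hδ.isUnit_map b).exists_left_inv
  obtain ⟨k, c, hc, rfl⟩ := hδ.exists_mem_map_component v
  have hx : X.x 0 ^ (k + j) ∈ X.component (k + j : ℕ) := by
    have := X.mk_mem_component
      (MvPolynomial.isHomogeneous_X_pow (R := K) (0 : Fin (n + 1)) (k + j))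
    rwa [map_pow] at this
  have h : c * b = X.x 0 ^ (k + j) := by
    refine hδ.injOn_component (k + j : ℕ) ?_ hx ?_
    · rw [Nat.cast_add]; exact X.mul_mem_component hc hj
    · rw [map_mul, map_pow, hδ.map_x_zero, one_pow]; exact hv
  refine ⟨k + j, ?_⟩
  rw [← h]
  exact (mul_smul c (b : X.coordRing) w).trans ((congrArg (c • ·) hb).trans (smul_zero c))

end IsDehomogenization

end ZeroDimSubscheme

/-! ### Partial derivatives of homogeneous polynomials -/

theorem MvPolynomial.pderiv_homogeneousComponent {σ R : Type*} [CommSemiring R] (j : σ) (m : ℕ)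
    (p : MvPolynomial σ R) :
    pderiv j (homogeneousComponent (m + 1) p) = homogeneousComponent m (pderiv j p) := by
  ext d
  rw [coeff_homogeneousComponent, coeff_pderiv, coeff_pderiv, coeff_homogeneousComponent]
  simp only [map_add, Finsupp.degree_single, add_left_inj]
  split_ifs <;> simp

theorem MvPolynomial.isHomogeneous_X_mul {σ R : Type*} [CommSemiring R] (j : σ) {m : ℕ}
    {p : MvPolynomial σ R} (hp : p.IsHomogeneous m) : (X j * p).IsHomogeneous (m + 1) :=
  add_comm 1 m ▸ (isHomogeneous_X R j).mul hp

theorem MvPolynomial.pderiv_mem_of_mem_sq {σ R : Type*} [CommRing R]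
    {I : Ideal (MvPolynomial σ R)} {p : MvPolynomial σ R} (hp : p ∈ I ^ 2) (j : σ) :
    pderiv j p ∈ I := by
  rw [pow_two] at hp
  induction hp using Submodule.mul_induction_on' with
  | mem_mul_mem a ha b hb =>
    rw [pderiv_mul]
    exact add_mem (I.mul_mem_left _ hb) (I.mul_mem_right _ ha)
  | add a _ b _ ha hb => rw [map_add]; exact add_mem ha hb

namespace ZeroDimSubscheme

variable {K : Type u} [Field K] {n : ℕ} (X : ZeroDimSubscheme K n)

open KaehlerDifferential

/-! ### A presentation of the Kähler differentials of the coordinate ring -/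

theorem mk_pderiv_mem_component {k : ℕ} {p : MvPolynomial (Fin (n + 1)) K}
    (hp : p.IsHomogeneous k) (j : Fin (n + 1)) :
    Ideal.Quotient.mk X.ideal (MvPolynomial.pderiv j p) ∈ X.component ((k : ℤ) - 1) := by
  rcases k with _ | k
  · obtain ⟨c, rfl⟩ : ∃ c, p = MvPolynomial.C c :=
      ⟨_, (MvPolynomial.totalDegree_eq_zero_iff_eq_C).1
        ((MvPolynomial.totalDegree_zero_iff_isHomogeneous _).2 hp)⟩
    simp
  · rw [Nat.cast_add, Nat.cast_one, add_sub_cancel_right]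
    refine X.mk_mem_component ?_
    rw [← MvPolynomial.homogeneousComponent_eq_self hp, MvPolynomial.pderiv_homogeneousComponent]
    exact MvPolynomial.homogeneousComponent_isHomogeneous _ _

theorem D_mk (p : MvPolynomial (Fin (n + 1)) K) :
    D K X.coordRing (Ideal.Quotient.mk X.ideal p) =
      ∑ j, Ideal.Quotient.mk X.ideal (MvPolynomial.pderiv j p) • D K X.coordRing (X.x j) := by
  have h := congrArg (KaehlerDifferential.map K K (MvPolynomial (Fin (n + 1)) K) X.coordRing)
    ((mvPolynomialBasis K (Fin (n + 1))).sum_repr (D K _ p))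
  rw [map_sum, KaehlerDifferential.map_D] at h
  refine h.symm.trans (Finset.sum_congr rfl fun j _ => ?_)
  rw [map_smul, mvPolynomialBasis_repr_apply, mvPolynomialBasis_apply, KaehlerDifferential.map_D]
  exact algebra_compatible_smul X.coordRing (MvPolynomial.pderiv j p) (D K X.coordRing (X.x j))

theorem exists_eq_sum_smul_D {i : ℤ} {w : Ω[X.coordRing⁄K]}
    (hw : w ∈ kaehlerComponent K X.component i) :
    ∃ f : Fin (n + 1) → X.coordRing, (∀ j, f j ∈ X.component (i - 1)) ∧
      w = ∑ j, f j • D K X.coordRing (X.x j) := by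
  induction hw using Submodule.span_induction with
  | mem w hw =>
    obtain ⟨a, b, rfl, f, hf, g, hg, rfl⟩ := hw
    rcases lt_or_ge b 0 with hb | hb
    · rw [X.component_of_neg hb, Submodule.mem_bot] at hg
      refine ⟨0, fun j => zero_mem _, ?_⟩
      rw [hg, map_zero, smul_zero f]
      exact (Finset.sum_eq_zero fun j _ => zero_smul X.coordRing (D K X.coordRing (X.x j))).symm
    · lift b to ℕ using hb
      obtain ⟨p, hp, rfl⟩ := X.mem_component_natCast.1 hg
      refine ⟨fun j => f * Ideal.Quotient.mk X.ideal (MvPolynomial.pderiv j p), fun j => ?_, ?_⟩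
      · rw [add_sub_assoc]
        exact X.mul_mem_component hf (X.mk_pderiv_mem_component hp j)
      · rw [D_mk, Finset.smul_sum (M := X.coordRing) (N := Ω[X.coordRing⁄K])]
        exact Finset.sum_congr rfl fun j _ => (mul_smul f _ (D K X.coordRing (X.x j))).symm
  | zero =>
    exact ⟨0, fun j => zero_mem _, (Finset.sum_eq_zero fun j _ =>
      zero_smul X.coordRing (D K X.coordRing (X.x j))).symm⟩
  | add v w _ _ hv hw =>
    obtain ⟨f, hf, rfl⟩ := hv
    obtain ⟨g, hg, rfl⟩ := hw
    exact ⟨f + g, fun j => add_mem (hf j) (hg j), Finset.sum_add_distrib.symm.trans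
      (Finset.sum_congr rfl fun j _ => (add_smul (f j) (g j) (D K X.coordRing (X.x j))).symm)⟩
  | smul c w _ hw =>
    obtain ⟨f, hf, rfl⟩ := hw
    exact ⟨c • f, fun j => Submodule.smul_mem _ c (hf j), Finset.smul_sum.trans
      (Finset.sum_congr rfl fun j _ =>
        (smul_assoc c (f j) (D K X.coordRing (X.x j))).symm)⟩

theorem kaehlerComponent_eq_bot {i : ℤ} (hi : i ≤ 0) :
    kaehlerComponent K X.component i = ⊥ := by
  refine (Submodule.eq_bot_iff _).2 fun w hw => ?_
  obtain ⟨f, hf, rfl⟩ := X.exists_eq_sum_smul_D hw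
  refine Finset.sum_eq_zero fun j _ => ?_
  have h := hf j
  rw [X.component_of_neg (by omega), Submodule.mem_bot] at h
  rw [h, zero_smul X.coordRing (D K X.coordRing (X.x j))]

theorem x_zero_smul_mem_kaehlerComponent {i : ℤ} {w : Ω[X.coordRing⁄K]}
    (hw : w ∈ kaehlerComponent K X.component i) :
    X.x 0 • w ∈ kaehlerComponent K X.component (i + 1) := by
  induction hw using Submodule.span_induction with
  | mem w hw =>
    obtain ⟨a, b, rfl, f, hf, g, hg, rfl⟩ := hw
    rw [smul_smul (X.x 0) f (D K X.coordRing g)]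
    exact Submodule.subset_span
      ⟨1 + a, b, by ring, _, X.mul_mem_component (X.x_mem_component 0) hf, g, hg, rfl⟩
  | zero => rw [smul_zero (X.x 0)]; exact zero_mem _
  | add v w _ _ hv hw => rw [smul_add (X.x 0) v w]; exact add_mem hv hw
  | smul c w _ hw =>
    rw [← kaehlerDifferential_smul_comm c (X.x 0) w]
    exact Submodule.smul_mem _ c hw

/-- The relations between the `dx_j` in `Ω¹_{R/K}` are the differentials of the elements of the
vanishing ideal. -/
theorem exists_mem_ideal_of_sum_smul_D_eq_zero (F : Fin (n + 1) → MvPolynomial (Fin (n + 1)) K)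
    (h : ∑ j, Ideal.Quotient.mk X.ideal (F j) • D K X.coordRing (X.x j) = 0) :
    ∃ G ∈ X.ideal, ∀ j, F j - MvPolynomial.pderiv j G ∈ X.ideal := by
  let B := mvPolynomialBasis K (Fin (n + 1))
  let v : X.coordRing ⊗[MvPolynomial (Fin (n + 1)) K] Ω[MvPolynomial (Fin (n + 1)) K⁄K] :=
    ∑ j, Ideal.Quotient.mk X.ideal (F j) ⊗ₜ D K _ (MvPolynomial.X j)
  have hv : mapBaseChange K (MvPolynomial (Fin (n + 1)) K) X.coordRing v = 0 := by
    rw [← h, map_sum]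
    refine Finset.sum_congr rfl fun j _ => ?_
    rw [mapBaseChange_tmul, KaehlerDifferential.map_D]
    rfl
  obtain ⟨c, hc⟩ := ((exact_kerCotangentToTensor_mapBaseChange K
    (MvPolynomial (Fin (n + 1)) K) X.coordRing Ideal.Quotient.mk_surjective) v).1 hv
  obtain ⟨⟨G, hG⟩, rfl⟩ := Ideal.toCotangent_surjective _ c
  rw [kerCotangentToTensor_toCotangent] at hc
  refine ⟨G, Ideal.Quotient.eq_zero_iff_mem.1 hG, fun j => ?_⟩
  rw [← Ideal.Quotient.eq_zero_iff_mem, map_sub, sub_eq_zero]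
  have h1 := congrArg (fun u => (B.baseChange X.coordRing).repr u j) hc
  simp only [v, map_sum, Module.Basis.baseChange_repr_tmul, Finsupp.finsetSum_apply, B,
    mvPolynomialBasis_repr_apply, mvPolynomialBasis_repr_D_X] at h1
  rw [Finset.sum_eq_single j] at h1
  · rw [Finsupp.single_eq_same, one_smul] at h1
    rw [← h1]
    exact Algebra.smul_def _ _ |>.trans (mul_one _)
  · intro k _ hk
    rw [Finsupp.single_eq_of_ne hk.symm, zero_smul]
  · simp

theorem exists_isHomogeneous_of_sum_smul_D_eq_zero {m : ℕ}
    {F : Fin (n + 1) → MvPolynomial (Fin (n + 1)) K} (hF : ∀ j, (F j).IsHomogeneous m)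
    (h : ∑ j, Ideal.Quotient.mk X.ideal (F j) • D K X.coordRing (X.x j) = 0) :
    ∃ G ∈ X.ideal, G.IsHomogeneous (m + 1) ∧ ∀ j, F j - MvPolynomial.pderiv j G ∈ X.ideal := by
  obtain ⟨G, hG, hFG⟩ := X.exists_mem_ideal_of_sum_smul_D_eq_zero F h
  refine ⟨_, MvPolynomial.homogeneousComponent_mem_of_mem X.homogeneous hG (m + 1),
    MvPolynomial.homogeneousComponent_isHomogeneous _ _, fun j => ?_⟩
  have h1 := MvPolynomial.homogeneousComponent_mem_of_mem X.homogeneous (hFG j) m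
  rwa [map_sub, MvPolynomial.homogeneousComponent_eq_self (hF j),
    ← MvPolynomial.pderiv_homogeneousComponent] at h1

namespace IsDehomogenization

variable {X} {A : Type*} [CommRing A] [Algebra K A] {δ : X.coordRing →ₐ[K] A} {r : ℤ}

theorem mem_ideal_of_X_zero_mul_mem (hδ : X.IsDehomogenization δ)
    {p : MvPolynomial (Fin (n + 1)) K} (hp : MvPolynomial.X 0 * p ∈ X.ideal) : p ∈ X.ideal := by
  rw [← Ideal.Quotient.eq_zero_iff_mem, map_mul] at hp
  exact Ideal.Quotient.eq_zero_iff_mem.1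
    ((mul_left_mem_nonZeroDivisors_eq_zero_iff hδ.avoidsHyperplane).1 hp)

variable [Module.Finite K A]

theorem finite_kaehlerComponent (hδ : X.IsDehomogenization δ) (i : ℤ) :
    Module.Finite K (kaehlerComponent K X.component i) := by
  have := hδ.finite_component (i - 1)
  let φ : (Fin (n + 1) → X.component (i - 1)) →ₗ[K] Ω[X.coordRing⁄K] :=
    ∑ j, ((LinearMap.toSpanSingleton X.coordRing _ (D K X.coordRing (X.x j))).restrictScalars K ∘ₗ
      (X.component (i - 1)).subtype) ∘ₗ LinearMap.proj j
  have h : kaehlerComponent K X.component i ≤ LinearMap.range φ := by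
    intro w hw
    obtain ⟨f, hf, rfl⟩ := X.exists_eq_sum_smul_D hw
    exact ⟨fun j => ⟨f j, hf j⟩, by simp [φ]⟩
  exact Submodule.finiteDimensional_of_le h

/-! ### Bijectivity of `Φ` in large degrees -/

theorem exists_sub_X_zero_mul_mem_ideal (hδ : X.IsDehomogenization δ)
    (hr : IsRegularityIndex (hilbertFunction K X.component) r) {k : ℕ} (hk : r ≤ k)
    {p : MvPolynomial (Fin (n + 1)) K} (hp : p.IsHomogeneous (k + 1)) :
    ∃ q : MvPolynomial (Fin (n + 1)) K, q.IsHomogeneous k ∧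
      p - MvPolynomial.X 0 * q ∈ X.ideal := by
  obtain ⟨g, hg, h⟩ := hδ.exists_x_zero_mul_eq hr hk (by exact_mod_cast X.mk_mem_component hp)
  obtain ⟨q, hq, rfl⟩ := X.mem_component_natCast.1 hg
  refine ⟨q, hq, ?_⟩
  rw [← Ideal.Quotient.eq_zero_iff_mem, map_sub, map_mul, ← h, x, sub_self]

/-- In degrees beyond `2r + 1` every form is a multiple of `x_0` modulo the *square* of the
vanishing ideal: it is a sum of products of two forms of degrees greater than `r`, and each of
the two is a multiple of `x_0` modulo the vanishing ideal. -/
theorem exists_sub_X_zero_mul_mem_sq (hδ : X.IsDehomogenization δ)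
    (hr : IsRegularityIndex (hilbertFunction K X.component) r) {k : ℕ} (hk : 2 * r + 1 ≤ k)
    {p : MvPolynomial (Fin (n + 1)) K} (hp : p.IsHomogeneous (k + 1)) :
    ∃ q : MvPolynomial (Fin (n + 1)) K, q.IsHomogeneous k ∧
      p - MvPolynomial.X 0 * q ∈ X.ideal ^ 2 := by
  have hr0 := hδ.regularityIndex_nonneg hr
  lift r to ℕ using hr0
  obtain ⟨l, rfl, hl⟩ : ∃ l, k = l + r + 1 ∧ r ≤ l := ⟨k - r - 1, by omega, by omega⟩
  have hmul : p ∈ MvPolynomial.homogeneousSubmodule (Fin (n + 1)) K (l + 1) *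
      MvPolynomial.homogeneousSubmodule (Fin (n + 1)) K (r + 1) := by
    rw [← MvPolynomial.homogeneousSubmodule_one_pow K (l + 1),
      ← MvPolynomial.homogeneousSubmodule_one_pow K (r + 1), ← pow_add,
      MvPolynomial.homogeneousSubmodule_one_pow, show l + 1 + (r + 1) = l + r + 1 + 1 by ring]
    exact hp
  clear hp
  induction hmul using Submodule.mul_induction_on' with
  | mem_mul_mem a ha b hb =>
    obtain ⟨a', ha', haI⟩ := hδ.exists_sub_X_zero_mul_mem_ideal hr (by exact_mod_cast hl) ha
    obtain ⟨b', hb', hbI⟩ := hδ.exists_sub_X_zero_mul_mem_ideal hr le_rfl hb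
    refine ⟨a' * b + (a - MvPolynomial.X 0 * a') * b', ?_, ?_⟩
    · refine (ha'.mul hb).add ?_
      have h1 : (a - MvPolynomial.X 0 * a').IsHomogeneous (l + 1) := by
        exact MvPolynomial.IsHomogeneous.sub ha
          (MvPolynomial.isHomogeneous_X_mul 0 ha')
      convert! h1.mul hb' using 1
      ring
    · have h : a * b - MvPolynomial.X 0 * (a' * b + (a - MvPolynomial.X 0 * a') * b') =
          (a - MvPolynomial.X 0 * a') * (b - MvPolynomial.X 0 * b') := by ring
      rw [h, pow_two]
      exact Ideal.mul_mem_mul haI hbI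
  | add a _ b _ ha hb =>
    obtain ⟨a', ha', haI⟩ := ha
    obtain ⟨b', hb', hbI⟩ := hb
    refine ⟨a' + b', ha'.add hb', ?_⟩
    convert! add_mem haI hbI using 1
    ring

/-- If `x_0 ∑ F_j dx_j = 0`, then `X_0 F_j` is modulo the vanishing ideal the `j`-th partial
derivative of a form `G` in that ideal. Such a form is `X_0 q` modulo the square of the ideal, so
that `F_j` is the partial derivative of `q`. -/
theorem eq_zero_of_x_zero_smul_eq_zero (hδ : X.IsDehomogenization δ)
    (hr : IsRegularityIndex (hilbertFunction K X.component) r) {i : ℤ} (hi : 2 * r + 1 ≤ i)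
    {w : Ω[X.coordRing⁄K]} (hw : w ∈ kaehlerComponent K X.component i)
    (h0 : X.x 0 • w = 0) : w = 0 := by
  have hr0 := hδ.regularityIndex_nonneg hr
  obtain ⟨m, rfl⟩ : ∃ m : ℕ, i = m + 1 := ⟨(i - 1).toNat, by omega⟩
  obtain ⟨f, hf, rfl⟩ := X.exists_eq_sum_smul_D hw
  rw [add_sub_cancel_right] at hf
  choose F hF hFf using fun j => X.mem_component_natCast.1 (hf j)
  obtain ⟨G, hG, hGhom, hFG⟩ := X.exists_isHomogeneous_of_sum_smul_D_eq_zero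
    (F := fun j => MvPolynomial.X 0 * F j) (m := m + 1)
    (fun j => MvPolynomial.isHomogeneous_X_mul 0 (hF j)) (by
      rw [← h0, Finset.smul_sum (M := X.coordRing) (N := Ω[X.coordRing⁄K])]
      refine Finset.sum_congr rfl fun j _ => ?_
      rw [map_mul, hFf, smul_smul (X.x 0) (f j) (D K X.coordRing (X.x j))]
      rfl)
  obtain ⟨q, -, hq⟩ := hδ.exists_sub_X_zero_mul_mem_sq hr (by exact_mod_cast hi) hGhom
  have hqI : q ∈ X.ideal := by
    refine hδ.mem_ideal_of_X_zero_mul_mem ?_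
    have h := sub_mem hG (Ideal.pow_le_self two_ne_zero hq)
    rwa [sub_sub_cancel] at h
  have hFq : ∀ j, F j - MvPolynomial.pderiv j q ∈ X.ideal := by
    intro j
    refine hδ.mem_ideal_of_X_zero_mul_mem ?_
    have h1 := MvPolynomial.pderiv_mem_of_mem_sq hq j
    rw [map_sub, MvPolynomial.pderiv_mul] at h1
    have h2 := add_mem (add_mem (hFG j) h1)
      (X.ideal.mul_mem_left (MvPolynomial.pderiv j (MvPolynomial.X 0)) hqI)
    convert! h2 using 1
    ring
  have h : D K X.coordRing (Ideal.Quotient.mk X.ideal q) = 0 := by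
    rw [Ideal.Quotient.eq_zero_iff_mem.2 hqI, map_zero]
  rw [← h, D_mk]
  refine Finset.sum_congr rfl fun j _ => ?_
  rw [← hFf, Ideal.Quotient.eq.2 (hFq j)]

/-- The kernel of `Φ` consists of elements annihilated by powers of `x_0`, while `x_0` acts
injectively in the stated degrees. -/
theorem injOn_Phi (hδ : X.IsDehomogenization δ)
    (hr : IsRegularityIndex (hilbertFunction K X.component) r) {i : ℤ} (hi : 2 * r + 1 ≤ i) :
    Set.InjOn X.Phi (kaehlerComponent K X.component i) := by
  have h : ∀ (N : ℕ) (i : ℤ), 2 * r + 1 ≤ i → ∀ w ∈ kaehlerComponent K X.component i,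
      X.x 0 ^ N • w = 0 → w = 0 := by
    intro N
    induction N with
    | zero => intro i _ w _ h; rwa [pow_zero, one_smul X.coordRing w] at h
    | succ N ih =>
      intro i hi w hw h
      rw [pow_succ, mul_smul (X.x 0 ^ N) (X.x 0) w] at h
      exact hδ.eq_zero_of_x_zero_smul_eq_zero hr hi hw
        (ih (i + 1) (by omega) _ (X.x_zero_smul_mem_kaehlerComponent hw) h)
  intro v hv w hw hvw
  obtain ⟨N, hN⟩ := hδ.exists_x_zero_pow_smul_eq_zero (w := v - w)
    (by rw [map_sub, hvw, sub_self])
  exact sub_eq_zero.1 (h N i hi _ (sub_mem hv hw) hN)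

/-- In the stated degrees one can lift `s dt` to `f dg` with `f` and `g` homogeneous of degree at
least `r`; the difference is a multiple of `dx_0`, which can be lifted as well. -/
theorem surjOn_Phi (hδ : X.IsDehomogenization δ)
    (hr : IsRegularityIndex (hilbertFunction K X.component) r) {i : ℤ} (hi : 2 * r ≤ i)
    (hi' : r + 1 ≤ i) :
    Set.SurjOn X.Phi (kaehlerComponent K X.component i)
      (kaehlerComponent K X.truncComponent i) := by
  have hr0 := hδ.regularityIndex_nonneg hr
  lift r to ℕ using hr0
  let ψ : Ω[X.coordRing⁄K] →ₗ[K] A[X] × (K[X] ⊗[K] Ω[A⁄K]) :=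
    hδ.splitEquiv.toLinearMap ∘ₗ X.Phi.restrictScalars K
  have hdx : ∀ (m : ℕ) (s : A), (m : ℤ) + 1 = i →
      (Polynomial.monomial m s, 0) ∈ (kaehlerComponent K X.component i).map ψ := by
    intro m s hm
    obtain ⟨f, hf, rfl⟩ := hδ.exists_mem_component hr (i := m) (by omega) s
    exact ⟨_, Submodule.subset_span ⟨m, 1, hm, f, hf, _, X.x_mem_component 0, rfl⟩,
      hδ.splitEquiv_Phi_x_zero hf⟩
  have hle : polynomialKaehlerComponent K A i ≤ (kaehlerComponent K X.component i).map ψ := by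
    refine Submodule.span_le.2 ?_
    rintro _ (⟨m, s, hm, rfl⟩ | ⟨m, η, hm, rfl⟩)
    · exact hdx m s hm
    · induction η using kaehlerDifferential_induction with
      | zero => rw [TensorProduct.tmul_zero]; exact zero_mem _
      | add η ζ hη hζ =>
        rw [TensorProduct.tmul_add, ← add_zero (0 : A[X]), ← Prod.mk_add_mk]
        exact add_mem hη hζ
      | smul_D s t =>
        obtain ⟨l, rfl⟩ : ∃ l, m = r + l := ⟨m - r, by omega⟩
        obtain ⟨f, hf, rfl⟩ := hδ.exists_mem_component hr le_rfl s
        obtain ⟨g, hg, rfl⟩ := hδ.exists_mem_component hr (i := l) (by omega) t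
        have h1 : ψ (f • D K X.coordRing g) ∈ (kaehlerComponent K X.component i).map ψ :=
          Submodule.mem_map_of_mem
            (Submodule.subset_span ⟨r, l, by rw [← hm]; push_cast; rfl, f, hf, g, hg, rfl⟩)
        have h2 : ψ (f • D K X.coordRing g) =
            (Polynomial.monomial (r + (l - 1)) (δ f * (δ g * l)),
              (Polynomial.X ^ (r + l) : K[X]) ⊗ₜ[K] (δ f • D K A (δ g))) := by
          change hδ.splitEquiv (X.Phi _) = _
          rw [Phi_smul_D, hδ.splitEquiv_smul_D (hδ.truncEquiv_incl_of_mem hf)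
            (hδ.truncEquiv_incl_of_mem hg)]
        have h3 : (Polynomial.monomial (r + (l - 1)) (δ f * (δ g * l)), 0) ∈
            (kaehlerComponent K X.component i).map ψ := by
          rcases l with _ | l
          · simp only [Nat.cast_zero, mul_zero, map_zero]
            exact zero_mem _
          · exact hdx _ _ (by rw [← hm]; push_cast; simp [add_assoc])
        have h4 := sub_mem h1 h3
        rw [h2, Prod.mk_sub_mk, sub_self, sub_zero] at h4
        exact h4
  intro w hw
  obtain ⟨v, hv, hvw⟩ := hle (hδ.map_kaehlerComponent i ▸ Submodule.mem_map_of_mem hw)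
  exact ⟨v, hv, hδ.splitEquiv.injective hvw⟩

theorem bijOn_Phi (hδ : X.IsDehomogenization δ)
    (hr : IsRegularityIndex (hilbertFunction K X.component) r) {i : ℤ} (hi : 2 * r + 1 ≤ i) :
    Set.BijOn X.Phi (kaehlerComponent K X.component i) (kaehlerComponent K X.truncComponent i) :=
  have hr0 := hδ.regularityIndex_nonneg hr
  ⟨X.mapsTo_Phi i, hδ.injOn_Phi hr hi, hδ.surjOn_Phi hr (by omega) (by omega)⟩

theorem hilbertFunction_kaehlerComponent (hδ : X.IsDehomogenization δ)
    (hr : IsRegularityIndex (hilbertFunction K X.component) r) {i : ℤ} (hi : 2 * r + 1 ≤ i) :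
    hilbertFunction K (kaehlerComponent K X.component) i =
      Module.finrank K A + Module.finrank K (Ω[A⁄K]) := by
  have hr0 := hδ.regularityIndex_nonneg hr
  have h := hδ.bijOn_Phi hr hi
  rw [← hδ.finrank_kaehlerComponent_truncComponent (i := i) (by omega)]
  refine (LinearEquiv.ofBijective ((X.Phi.restrictScalars K).restrict h.mapsTo) ⟨?_, ?_⟩).finrank_eq
  · exact fun v w hvw => Subtype.ext (h.injOn v.2 w.2 (congrArg Subtype.val hvw))
  · rintro ⟨w, hw⟩
    obtain ⟨v, hv, rfl⟩ := h.surjOn hw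
    exact ⟨⟨v, hv⟩, rfl⟩

end IsDehomogenization

end ZeroDimSubscheme

/-! ### Homogenization in two variables -/

namespace Polynomial

variable {K : Type*} [Field K]

/-- The homogenization of degree `m` of a univariate polynomial, in which `X_0` is the new variable
and `X_1` the old one. In `Polynomial.homogenize` the two variables have the opposite roles. -/
def homogenizeZero (p : K[X]) (m : ℕ) : MvPolynomial (Fin 2) K :=
  MvPolynomial.rename (Equiv.swap 0 1) (p.homogenize m)

theorem isHomogeneous_homogenizeZero (p : K[X]) (m : ℕ) :
    (p.homogenizeZero m).IsHomogeneous m :=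
  (isHomogeneous_homogenize p).rename_isHomogeneous

theorem aeval_homogenizeZero (p : K[X]) {m : ℕ} (hm : p.natDegree ≤ m) :
    MvPolynomial.aeval ![1, X] (p.homogenizeZero m) = p := by
  have h : (![1, X] : Fin 2 → K[X]) ∘ Equiv.swap 0 1 = ![X, 1] := by
    ext i : 1
    fin_cases i <;> simp
  rw [homogenizeZero, MvPolynomial.aeval_rename, h, aeval_homogenize_X_one p hm]

theorem homogenizeZero_aeval {q : MvPolynomial (Fin 2) K} {m : ℕ} (hq : q.IsHomogeneous m) :
    (MvPolynomial.aeval ![1, X] q : K[X]).homogenizeZero m = q := by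
  have h : (![X, 1] : Fin 2 → K[X]) ∘ Equiv.swap 0 1 = ![1, X] := by
    ext i : 1
    fin_cases i <;> simp
  have h1 := homogenize_eq_of_isHomogeneous
    (q := MvPolynomial.rename (Equiv.swap (0 : Fin 2) 1) q)
    (hq.rename_isHomogeneous (f := Equiv.swap (0 : Fin 2) 1)) rfl
  rw [MvPolynomial.aeval_rename, h] at h1
  rw [homogenizeZero, h1, MvPolynomial.rename_rename]
  have h2 : (Equiv.swap (0 : Fin 2) 1 : Fin 2 → Fin 2) ∘ Equiv.swap 0 1 = id := by
    ext i : 1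
    simp
  rw [h2, MvPolynomial.rename_id_apply]

theorem homogenizeZero_mul (p q : K[X]) {m l : ℕ} (hp : p.natDegree ≤ m) (hq : q.natDegree ≤ l) :
    (p * q).homogenizeZero (m + l) = p.homogenizeZero m * q.homogenizeZero l := by
  rw [homogenizeZero, homogenize_mul p q hp hq, map_mul, homogenizeZero, homogenizeZero]

theorem natDegree_aeval_le {q : MvPolynomial (Fin 2) K} {m : ℕ} (hq : q.IsHomogeneous m) :
    (MvPolynomial.aeval ![1, X] q : K[X]).natDegree ≤ m := by
  rw [MvPolynomial.aeval_def, MvPolynomial.eval₂_eq]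
  refine natDegree_sum_le_of_forall_le _ _ fun d hd => ?_
  have h := hq.degree_eq_sum_deg_support hd
  rw [Finset.prod_subset (Finset.subset_univ _) (by simp +contextual), Fin.prod_univ_two,
    algebraMap_eq]
  simp only [Matrix.cons_val_zero, one_pow, one_mul, Matrix.cons_val_one]
  refine (natDegree_C_mul_X_pow_le _ _).trans ?_
  rw [h]
  exact Finsupp.le_degree 1 d

theorem aeval_zero_one_homogenizeZero (p : K[X]) (m : ℕ) :
    MvPolynomial.aeval ![(0 : K), 1] (p.homogenizeZero m) = p.coeff m := by
  have h : (![0, 1] : Fin 2 → K) ∘ Equiv.swap 0 1 = ![1, 0] := by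
    ext i : 1
    fin_cases i <;> simp
  rw [homogenizeZero, MvPolynomial.aeval_rename, h, homogenize, map_sum,
    Finset.sum_eq_single (m, 0)]
  · simp [MvPolynomial.aeval_monomial, Finsupp.prod_fintype]
  · rintro ⟨a, b⟩ hab hne
    have hb : b ≠ 0 := by
      rintro rfl
      exact hne (by simpa using hab)
    simp [MvPolynomial.aeval_monomial, Finsupp.prod_fintype, hb]
  · intro h
    simp at h

theorem aeval_pderiv_one (q : MvPolynomial (Fin 2) K) :
    (MvPolynomial.aeval ![1, X] (MvPolynomial.pderiv 1 q) : K[X]) =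
      derivative (MvPolynomial.aeval ![1, X] q) := by
  induction q using MvPolynomial.induction_on with
  | C a => simp
  | add p q hp hq => simp [hp, hq]
  | mul_X p i hp =>
    rw [MvPolynomial.pderiv_mul, map_add, map_mul, map_mul, map_mul, hp, derivative_mul]
    fin_cases i <;> simp

theorem eq_zero_of_aeval_eq_zero {q : MvPolynomial (Fin 2) K} {m : ℕ} (hq : q.IsHomogeneous m)
    (h : (MvPolynomial.aeval ![1, X] q : K[X]) = 0) : q = 0 := by
  rw [← homogenizeZero_aeval hq, h, homogenizeZero.eq_1, homogenize_zero, map_zero]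

theorem exists_homogenizeZero_mul_eq {f : K[X]} {q : MvPolynomial (Fin 2) K} {m : ℕ}
    (hq : q.IsHomogeneous (f.natDegree + m)) (h : f ∣ MvPolynomial.aeval ![1, X] q) :
    ∃ g : MvPolynomial (Fin 2) K, g.IsHomogeneous m ∧ q = f.homogenizeZero f.natDegree * g := by
  obtain ⟨g, hg⟩ := h
  by_cases h0 : f * g = 0
  · exact ⟨0, MvPolynomial.isHomogeneous_zero _ _ _, by
      rw [mul_zero, eq_zero_of_aeval_eq_zero hq (hg.trans h0)]⟩
  · have hd := natDegree_aeval_le hq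
    rw [hg, natDegree_mul (left_ne_zero_of_mul h0) (right_ne_zero_of_mul h0)] at hd
    exact ⟨_, isHomogeneous_homogenizeZero g m, by
      rw [← homogenizeZero_mul f g le_rfl (by omega), ← hg, homogenizeZero_aeval hq]⟩

theorem homogenizeZero_dvd_of_dvd_aeval {f : K[X]} {q : MvPolynomial (Fin 2) K} {m : ℕ}
    (hq : q.IsHomogeneous m) (h : f ∣ MvPolynomial.aeval ![1, X] q) :
    f.homogenizeZero f.natDegree ∣ q := by
  rcases lt_or_ge m f.natDegree with hm | hm
  · rw [eq_zero_of_aeval_eq_zero hq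
      (eq_zero_of_dvd_of_natDegree_lt h ((natDegree_aeval_le hq).trans_lt hm))]
    exact dvd_zero _
  · obtain ⟨l, rfl⟩ := Nat.exists_eq_add_of_le hm
    obtain ⟨g, -, rfl⟩ := exists_homogenizeZero_mul_eq hq h
    exact dvd_mul_right _ _

/-- Over any field there are separable polynomials of every positive degree `d`: the polynomial
`X ^ d - 1` if the characteristic does not divide `d`, and `X ^ d - X` otherwise. -/
theorem exists_monic_separable (K : Type*) [Field K] (m : ℕ) :
    ∃ f : K[X], f.Monic ∧ f.Separable ∧ f.natDegree = m + 1 := by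
  by_cases h : ((m + 1 : ℕ) : K) = 0
  · have hm : 1 < m + 1 := by
      by_contra! hm
      obtain rfl : m = 0 := by omega
      simp at h
    refine ⟨X ^ (m + 1) - X, monic_X_pow_sub (by rw [degree_X]; exact_mod_cast (by omega)), ?_, ?_⟩
    · refine ⟨0, -1, ?_⟩
      rw [derivative_sub, derivative_X_pow, derivative_X, h]
      simp
    · exact natDegree_sub_eq_left_of_natDegree_lt (by simpa using hm) |>.trans (natDegree_X_pow _)
  · exact ⟨X ^ (m + 1) - 1, monic_X_pow_sub_C 1 m.succ_ne_zero, X_pow_sub_one_separable_iff.2 h,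
      natDegree_X_pow_sub_C (r := (1 : K))⟩

end Polynomial

/-! ### Subschemes of the projective line -/

namespace ZeroDimSubscheme

open Polynomial KaehlerDifferential

variable {K : Type u} [Field K] {f : K[X]}

theorem not_X_zero_dvd_homogenizeZero (hf : f.Monic) :
    ¬ MvPolynomial.X 0 ∣ f.homogenizeZero f.natDegree := by
  rintro ⟨q, hq⟩
  have h := congrArg (MvPolynomial.aeval ![(0 : K), 1]) hq
  rw [aeval_zero_one_homogenizeZero, map_mul, MvPolynomial.aeval_X, coeff_natDegree,
    hf.leadingCoeff] at h
  simp at h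

theorem dvd_of_dvd_X_zero_pow_mul (hf : f.Monic) {q : MvPolynomial (Fin 2) K} {k : ℕ}
    (h : f.homogenizeZero f.natDegree ∣ MvPolynomial.X 0 ^ k * q) :
    f.homogenizeZero f.natDegree ∣ q := by
  obtain ⟨g, hg⟩ := h
  obtain ⟨l, rfl⟩ := MvPolynomial.X_prime.pow_dvd_of_dvd_mul_left k
    (not_X_zero_dvd_homogenizeZero hf) (Dvd.intro _ hg)
  refine ⟨l, mul_left_cancel₀ (pow_ne_zero k (MvPolynomial.X_ne_zero (R := K) 0)) ?_⟩
  rw [hg]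
  ring

theorem X_zero_mem_nonZeroDivisors (hf : f.Monic) :
    Ideal.Quotient.mk (Ideal.span {f.homogenizeZero f.natDegree}) (MvPolynomial.X 0) ∈
      nonZeroDivisors (MvPolynomial (Fin 2) K ⧸ Ideal.span {f.homogenizeZero f.natDegree}) := by
  refine mem_nonZeroDivisors_iff_right.2 fun g hg => ?_
  obtain ⟨q, rfl⟩ := Ideal.Quotient.mk_surjective g
  rw [← map_mul, Ideal.Quotient.eq_zero_iff_mem, Ideal.mem_span_singleton] at hg
  rw [Ideal.Quotient.eq_zero_iff_mem, Ideal.mem_span_singleton]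
  exact dvd_of_dvd_X_zero_pow_mul (k := 1) hf (by rwa [pow_one, mul_comm])

/-- The upper bound holds since `F ≠ 0` in a ring of dimension two, the lower bound since `X_0` is a
non-zerodivisor but not a unit modulo `F`. -/
theorem ringKrullDim_quotient_homogenizeZero (hf : f.Monic) (hd : f.natDegree ≠ 0) :
    ringKrullDim (MvPolynomial (Fin 2) K ⧸ Ideal.span {f.homogenizeZero f.natDegree}) = 1 := by
  have hF : f.homogenizeZero f.natDegree ≠ 0 := fun h =>
    not_X_zero_dvd_homogenizeZero hf (h ▸ dvd_zero _)
  apply le_antisymm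
  · have h := ringKrullDim_quotient_succ_le_of_nonZeroDivisor (mem_nonZeroDivisors_of_ne_zero hF)
    rw [MvPolynomial.ringKrullDim_of_isNoetherianRing, ringKrullDim_eq_zero_of_field,
      Nat.card_fin, zero_add] at h
    generalize ringKrullDim
      (MvPolynomial (Fin 2) K ⧸ Ideal.span {f.homogenizeZero f.natDegree}) = e at h ⊢
    induction e with
    | bot => exact bot_le
    | coe e =>
      have h2 : e + 1 ≤ 1 + 1 := by
        rw [one_add_one_eq_two]
        exact WithBot.coe_le_coe.1 h
      exact_mod_cast (ENat.add_le_add_iff_right ENat.one_ne_top).1 h2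
  · refine le_trans ?_
      (ringKrullDim_quotient_succ_le_of_nonZeroDivisor (X_zero_mem_nonZeroDivisors hf))
    have : Nontrivial ((MvPolynomial (Fin 2) K ⧸ Ideal.span {f.homogenizeZero f.natDegree}) ⧸
        Ideal.span {Ideal.Quotient.mk (Ideal.span {f.homogenizeZero f.natDegree})
          (MvPolynomial.X 0)}) := by
      rw [Ideal.Quotient.nontrivial_iff, Ne, Ideal.span_singleton_eq_top, isUnit_iff_exists_inv]
      rintro ⟨g, hg⟩
      obtain ⟨q, rfl⟩ := Ideal.Quotient.mk_surjective g
      rw [← map_mul, ← map_one (Ideal.Quotient.mk _), Ideal.Quotient.eq,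
        Ideal.mem_span_singleton] at hg
      obtain ⟨c, hc⟩ := hg
      -- Both `X_0` and the homogenization of `f` vanish at the origin.
      have h := congrArg MvPolynomial.constantCoeff hc
      rw [map_mul, map_sub, map_mul, MvPolynomial.constantCoeff_X, map_one,
        MvPolynomial.constantCoeff_eq,
        (isHomogeneous_homogenizeZero f f.natDegree).coeff_eq_zero (by simpa using hd.symm)] at h
      simp at h
    simpa using add_le_add_left ringKrullDim_nonneg_of_nontrivial (1 : WithBot ℕ∞)

/-- The subscheme of the projective line that consists of the zeros of the monic polynomial `f` in
the affine line `X_0 ≠ 0`. -/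
def zeroScheme (f : K[X]) (hf : f.Monic) (hd : f.natDegree ≠ 0) : ZeroDimSubscheme K 1 where
  ideal := Ideal.span {f.homogenizeZero f.natDegree}
  homogeneous := by
    refine Ideal.homogeneous_span _ _ fun p hp => ?_
    rw [Set.mem_singleton_iff.1 hp]
    exact ⟨f.natDegree, isHomogeneous_homogenizeZero f f.natDegree⟩
  saturated p := by
    rintro ⟨k, hk⟩
    rw [Ideal.mem_span_singleton]
    exact dvd_of_dvd_X_zero_pow_mul hf (Ideal.mem_span_singleton.1
      (hk _ (Ideal.pow_mem_pow (Ideal.subset_span (Set.mem_range_self 0)) k)))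
  dim_eq_one := ringKrullDim_quotient_homogenizeZero hf hd

variable (hf : f.Monic) (hd : f.natDegree ≠ 0)

theorem mem_ideal_zeroScheme_iff {p : MvPolynomial (Fin 2) K} :
    p ∈ (zeroScheme f hf hd).ideal ↔ f.homogenizeZero f.natDegree ∣ p :=
  Ideal.mem_span_singleton

/-- The dehomogenization `R → K[t]/(f)`, which sends `x_0` to `1` and `x_1` to `t`. -/
def zeroSchemeDeh : (zeroScheme f hf hd).coordRing →ₐ[K] AdjoinRoot f :=
  Ideal.Quotient.liftₐ _ ((AdjoinRoot.mkₐ f).comp (MvPolynomial.aeval ![1, X])) (by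
    intro p hp
    obtain ⟨q, rfl⟩ := (mem_ideal_zeroScheme_iff hf hd).1 hp
    rw [map_mul, AlgHom.comp_apply, aeval_homogenizeZero f le_rfl]
    exact mul_eq_zero_of_left AdjoinRoot.mk_self _)

theorem zeroSchemeDeh_mk (p : MvPolynomial (Fin 2) K) :
    zeroSchemeDeh hf hd (Ideal.Quotient.mk _ p) =
      AdjoinRoot.mk f (MvPolynomial.aeval ![1, X] p) :=
  rfl

theorem isDehomogenization_zeroSchemeDeh :
    (zeroScheme f hf hd).IsDehomogenization (zeroSchemeDeh hf hd) where
  surjective s := by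
    obtain ⟨p, rfl⟩ := AdjoinRoot.mk_surjective s
    exact ⟨Ideal.Quotient.mk _ (p.homogenizeZero p.natDegree), by
      rw [zeroSchemeDeh_mk, aeval_homogenizeZero p le_rfl]⟩
  map_x_zero := by
    rw [x, zeroSchemeDeh_mk, MvPolynomial.aeval_X]
    exact map_one _
  eq_zero k g hg h := by
    obtain ⟨p, hp, rfl⟩ := (zeroScheme f hf hd).mem_component_natCast.1 hg
    rw [zeroSchemeDeh_mk, AdjoinRoot.mk_eq_zero] at h
    exact Ideal.Quotient.eq_zero_iff_mem.2
      ((mem_ideal_zeroScheme_iff hf hd).2 (homogenizeZero_dvd_of_dvd_aeval hp h))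

/-- The space `δ(R_i)` consists of the residue classes of the polynomials of degree at most `i`. -/
theorem isRegularityIndex_zeroScheme :
    IsRegularityIndex (hilbertFunction K (zeroScheme f hf hd).component)
      ((f.natDegree : ℤ) - 1) := by
  have hδ := isDehomogenization_zeroSchemeDeh hf hd
  have : Module.Finite K (AdjoinRoot f) := hf.finite_adjoinRoot
  have hA : Module.finrank K (AdjoinRoot f) = f.natDegree := by
    rw [(AdjoinRoot.powerBasis' hf).finrank, AdjoinRoot.powerBasis'_dim]
  refine isRegularityIndex_of_ne (c := f.natDegree) (fun i hi => ?_) ?_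
  · rw [hδ.hilbertFunction_component, ← hA]
    lift i to ℕ using (by omega)
    have htop : ((zeroScheme f hf hd).component i).map (zeroSchemeDeh hf hd).toLinearMap = ⊤ := ?_
    · rw [htop, finrank_top]
    refine eq_top_iff.2 fun s _ => ?_
    obtain ⟨p, rfl⟩ := AdjoinRoot.mk_surjective s
    have hlt := natDegree_modByMonic_lt p hf (fun h => hd (h ▸ natDegree_one))
    refine ⟨_, (zeroScheme f hf hd).mk_mem_component
      (isHomogeneous_homogenizeZero (p %ₘ f) i), ?_⟩
    refine (zeroSchemeDeh_mk hf hd _).trans ?_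
    rw [aeval_homogenizeZero _ (by omega), ← sub_eq_zero, ← map_sub, AdjoinRoot.mk_eq_zero]
    exact ⟨-(p /ₘ f), by linear_combination modByMonic_add_div p f⟩
  · rcases Nat.lt_or_ge f.natDegree 2 with h | h
    · rw [hilbertFunction, component_of_neg _ (by omega), finrank_bot]
      exact hd.symm
    · obtain ⟨i, hi⟩ : ∃ i, f.natDegree = i + 2 := ⟨_, (Nat.sub_add_cancel h).symm⟩
      have hi' : (f.natDegree : ℤ) - 1 - 1 = i := by omega
      have hle : ((zeroScheme f hf hd).component i).map (zeroSchemeDeh hf hd).toLinearMap ≤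
          (degreeLT K (i + 1)).map (AdjoinRoot.mkₐ f).toLinearMap := by
        rintro _ ⟨g, hg, rfl⟩
        obtain ⟨p, hp, rfl⟩ := (zeroScheme f hf hd).mem_component_natCast.1 hg
        refine ⟨_, mem_degreeLT.2 ?_, (zeroSchemeDeh_mk hf hd p).symm⟩
        exact (degree_le_of_natDegree_le (natDegree_aeval_le hp)).trans_lt
          (by exact_mod_cast i.lt_succ_self)
      have : Module.Finite K (degreeLT K (i + 1)) := Module.Finite.equiv (degreeLTEquiv K _).symm
      have h1 := (Submodule.finrank_mono hle).trans (Submodule.finrank_map_le _ _)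
      rw [(degreeLTEquiv K (i + 1)).finrank_eq, Module.finrank_fin_fun] at h1
      rw [hi', hδ.hilbertFunction_component]
      omega

/-- If `f` has degree `r + 1` and is separable, then there is a nonzero torsion element of degree
`2r`: the form `x_1^r dF`, where `F` is the homogenization of `f`, is zero, but division of its
coefficients by `x_0` yields a nonzero form. -/
theorem exists_ne_zero_Phi_eq_zero (hs : f.Separable) {r : ℕ} (hr : f.natDegree = r + 1)
    (hr0 : r ≠ 0) :
    ∃ w ∈ kaehlerComponent K (zeroScheme f hf hd).component (2 * r),
      (zeroScheme f hf hd).Phi w = 0 ∧ w ≠ 0 := by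
  have hδ := isDehomogenization_zeroSchemeDeh hf hd
  have : Module.Finite K (AdjoinRoot f) := hf.finite_adjoinRoot
  have hreg := isRegularityIndex_zeroScheme hf hd
  set X := zeroScheme f hf hd
  set F := f.homogenizeZero f.natDegree
  have hFhom : F.IsHomogeneous (r + 1) := hr ▸ isHomogeneous_homogenizeZero f f.natDegree
  have hFI : F ∈ X.ideal := Ideal.mem_span_singleton_self F
  obtain ⟨m, rfl⟩ : ∃ m, r = m + 1 := ⟨_, (Nat.succ_pred hr0).symm⟩
  have hdF : ∀ j, (MvPolynomial.X 1 ^ (m + 1) * MvPolynomial.pderiv j F).IsHomogeneous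
      (2 * m + 1 + 1) := by
    intro j
    have h := (MvPolynomial.isHomogeneous_X_pow (R := K) (1 : Fin 2) (m + 1)).mul
      (hFhom.pderiv (i := j))
    rwa [show m + 1 + (m + 1 + 1 - 1) = 2 * m + 1 + 1 by omega] at h
  choose q hq hqI using fun j => hδ.exists_sub_X_zero_mul_mem_ideal hreg
    (by rw [hr]; push_cast; omega) (hdF j)
  have hw0 : X.x 0 • ∑ j, Ideal.Quotient.mk X.ideal (q j) • D K X.coordRing (X.x j) = 0 := by
    have h : D K X.coordRing (Ideal.Quotient.mk X.ideal F) = 0 := by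
      rw [Ideal.Quotient.eq_zero_iff_mem.2 hFI, map_zero]
    refine Eq.trans ?_ (smul_zero (A := Ω[X.coordRing⁄K])
      (Ideal.Quotient.mk X.ideal (MvPolynomial.X 1 ^ (m + 1))))
    rw [← h, D_mk, Finset.smul_sum (M := X.coordRing) (N := Ω[X.coordRing⁄K]),
      Finset.smul_sum (M := X.coordRing) (N := Ω[X.coordRing⁄K])]
    refine Finset.sum_congr rfl fun j _ => ?_
    refine (smul_smul (X.x 0) _ (D K X.coordRing (X.x j))).trans
      (Eq.trans ?_ (mul_smul (α := X.coordRing) _ _ (D K X.coordRing (X.x j))))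
    rw [← map_mul, Ideal.Quotient.eq.2 (hqI j), map_mul]
    rfl
  refine ⟨∑ j, Ideal.Quotient.mk X.ideal (q j) • D K X.coordRing (X.x j), ?_, ?_, ?_⟩
  · refine sum_mem fun j _ => Submodule.subset_span
      ⟨_, 1, ?_, _, X.mk_mem_component (hq j), _, X.x_mem_component j, rfl⟩
    push_cast
    ring
  · refine hδ.eq_zero_of_incl_smul_eq_zero
      ⟨X.x 0, hδ.avoidsHyperplane, 1, X.x_mem_component 0⟩ ?_
    rw [← Phi_smul, hw0, map_zero]
  · intro hw
    obtain ⟨G, hG, hGhom, hqG⟩ := X.exists_isHomogeneous_of_sum_smul_D_eq_zero hq hw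
    have hGf : f ∣ MvPolynomial.aeval ![1, Polynomial.X] G := by
      obtain ⟨g, rfl⟩ := (mem_ideal_zeroScheme_iff hf hd).1 hG
      rw [map_mul, aeval_homogenizeZero f le_rfl]
      exact dvd_mul_right _ _
    obtain ⟨g, hg, rfl⟩ := exists_homogenizeZero_mul_eq (m := m)
      (by rwa [hr, show m + 1 + 1 + m = 2 * m + 1 + 1 by ring]) hGf
    -- A form whose product with `∂F/∂X_1` is divisible by `F`, although its degree is too small.
    let p := MvPolynomial.X 1 ^ (m + 1) - MvPolynomial.X 0 * g
    have hp : p.IsHomogeneous (m + 1) := MvPolynomial.IsHomogeneous.sub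
      (MvPolynomial.isHomogeneous_X_pow 1 (m + 1)) (MvPolynomial.isHomogeneous_X_mul 0 hg)
    have hpI : p * MvPolynomial.pderiv 1 F ∈ X.ideal := by
      have h := add_mem (add_mem (hqI 1) (X.ideal.mul_mem_left (MvPolynomial.X 0) (hqG 1)))
        (X.ideal.mul_mem_right (MvPolynomial.X 0 * MvPolynomial.pderiv 1 g) hFI)
      rw [MvPolynomial.pderiv_mul] at h
      convert! h using 1
      ring
    have hpf : f ∣ MvPolynomial.aeval ![1, Polynomial.X] p := by
      refine IsCoprime.dvd_of_dvd_mul_right hs ?_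
      obtain ⟨c, hc⟩ := (mem_ideal_zeroScheme_iff hf hd).1 hpI
      have h := congrArg (MvPolynomial.aeval (![1, Polynomial.X] : Fin 2 → K[X])) hc
      rw [map_mul, map_mul, aeval_pderiv_one, aeval_homogenizeZero f le_rfl] at h
      exact Dvd.intro _ h.symm
    have hp0 : p = 0 := eq_zero_of_aeval_eq_zero hp (eq_zero_of_dvd_of_natDegree_lt hpf
      ((natDegree_aeval_le hp).trans_lt (by omega)))
    have h := congrArg (MvPolynomial.aeval ![(0 : K), 1]) hp0
    simp [p] at h

/-- In degree `0` the module of differentials vanishes, and in degree `2r > 0` its dimension exceeds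
the Hilbert polynomial. -/
theorem isRegularityIndex_kaehlerComponent_zeroScheme (hs : f.Separable) {r : ℕ}
    (hr : f.natDegree = r + 1) :
    IsRegularityIndex (hilbertFunction K (kaehlerComponent K (zeroScheme f hf hd).component))
      (2 * (r : ℤ) + 1) := by
  have hδ := isDehomogenization_zeroSchemeDeh hf hd
  have : Module.Finite K (AdjoinRoot f) := hf.finite_adjoinRoot
  have hreg := isRegularityIndex_zeroScheme hf hd
  rw [hr, Nat.cast_add, Nat.cast_one, add_sub_cancel_right] at hreg
  refine isRegularityIndex_of_ne (fun i hi => hδ.hilbertFunction_kaehlerComponent hreg hi) ?_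
  rw [add_sub_cancel_right]
  have := hδ.nontrivial
  rcases Nat.eq_zero_or_pos r with rfl | hr0
  · rw [hilbertFunction, kaehlerComponent_eq_bot _ (by simp), finrank_bot]
    exact (Nat.add_pos_left Module.finrank_pos _).ne
  · intro h
    have hi : (1 : ℤ) ≤ 2 * r := by omega
    rw [← hδ.finrank_kaehlerComponent_truncComponent hi] at h
    have := hδ.finite_kaehlerComponent (2 * r)
    have := hδ.finite_kaehlerComponent_truncComponent hi
    -- `Φ` is surjective in degree `2r` but not injective.
    let φ := ((zeroScheme f hf hd).Phi.restrictScalars K).restrict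
      ((zeroScheme f hf hd).mapsTo_Phi (2 * r))
    have hφ : Function.Surjective φ := by
      rintro ⟨w, hw⟩
      obtain ⟨v, hv, rfl⟩ := hδ.surjOn_Phi hreg le_rfl (by omega) hw
      exact ⟨⟨v, hv⟩, rfl⟩
    obtain ⟨w, hw, hw0, hne⟩ := exists_ne_zero_Phi_eq_zero hf hd hs hr hr0.ne'
    have hinj := (LinearMap.injective_iff_surjective_of_finrank_eq_finrank h).2 hφ
    exact hne (congrArg Subtype.val
      (hinj (a₁ := ⟨w, hw⟩) (a₂ := 0) ((Subtype.ext hw0).trans (map_zero φ).symm)))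

end ZeroDimSubscheme

end

theorem mainTheorem1 (K : Type*) [Field K] [PerfectField K] :
    (∀ (n : ℕ) (X : ZeroDimSubscheme K n), X.AvoidsHyperplane →
      -- all vector spaces whose dimensions are considered are finite dimensional
      (∀ i : ℤ, Module.Finite K (X.component i)) ∧
      (∀ i : ℤ, Module.Finite K (kaehlerComponent K X.component i)) ∧
      Module.Finite K X.affineRing ∧
      Module.Finite K (Ω[X.affineRing⁄K]) ∧
      -- the inclusion of `R` into its truncated integral closure, the identification of the
      -- latter with `S[x_0]`, the resulting splitting, and the description of `Φ`
      Function.Injective X.incl ∧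
      (∃ θ : X.truncClosure ≃ₐ[K] X.affineRing[X],
        (∀ (k : ℕ), ∀ f ∈ X.component k, θ (X.incl f) = Polynomial.monomial k (X.deh f)) ∧
        (∀ i : ℤ, (X.truncComponent i).map θ.toLinearMap = X.polyComponent i) ∧
        ∃ e : Ω[X.truncClosure⁄K] ≃ₗ[K] X.splitModule,
          (∀ w, e (X.incl (X.x 0) • w) =
            (Polynomial.X * (e w).1, (Polynomial.X : K[X]) • (e w).2)) ∧
          (∀ i : ℤ, (kaehlerComponent K X.truncComponent i).map e.toLinearMap =
            X.splitComponent i) ∧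
          (∀ F : X.affineRing[X],
            e (θ.symm F • KaehlerDifferential.D K X.truncClosure (X.incl (X.x 0))) = (F, 0)) ∧
          (∀ (m : ℕ) (s t : X.affineRing),
            e (θ.symm (Polynomial.monomial m s) •
                KaehlerDifferential.D K X.truncClosure (θ.symm (Polynomial.C t))) =
              (0, (Polynomial.X ^ m : K[X]) ⊗ₜ[K]
                (s • KaehlerDifferential.D K X.affineRing t))) ∧
          (∀ (k : ℕ), ∀ f ∈ X.component k, ∀ i : Fin (n + 1), i ≠ 0 →
            e (X.Phi (f • KaehlerDifferential.D K X.coordRing (X.x i))) =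
              (Polynomial.monomial k (X.deh f * X.deh (X.x i)),
                (Polynomial.X ^ (k + 1) : K[X]) ⊗ₜ[K]
                  (X.deh f • KaehlerDifferential.D K X.affineRing (X.deh (X.x i))))) ∧
          (∀ (k : ℕ), ∀ f ∈ X.component k,
            e (X.Phi (f • KaehlerDifferential.D K X.coordRing (X.x 0))) =
              (Polynomial.monomial k (X.deh f), 0))) ∧
      -- `Φ` is graded
      (∀ i : ℤ, Set.MapsTo X.Phi (kaehlerComponent K X.component i)
        (kaehlerComponent K X.truncComponent i)) ∧
      -- the kernel of `Φ` is the torsion submodule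
      LinearMap.ker X.Phi = X.torsionKaehler ∧
      -- the regularity index `r` and the degree `d` of the scheme
      ∃ (r : ℤ) (d : ℕ),
        IsRegularityIndex (hilbertFunction K X.component) r ∧
        HasHilbertPolynomial (hilbertFunction K X.component) d ∧
        (∀ i : ℤ, 2 * r + 1 ≤ i → Set.BijOn X.Phi (kaehlerComponent K X.component i)
          (kaehlerComponent K X.truncComponent i)) ∧
        HasHilbertPolynomial (hilbertFunction K (kaehlerComponent K X.component))
          (d + Module.finrank K (Ω[X.affineRing⁄K])) ∧
        ∃ ρ : ℤ,
          IsRegularityIndex (hilbertFunction K (kaehlerComponent K X.component)) ρ ∧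
          ρ ≤ 2 * r + 1) ∧
    -- the bound for the regularity index is sharp, for every value of `r`
    (∀ r : ℕ, ∃ (n : ℕ) (X : ZeroDimSubscheme K n), X.AvoidsHyperplane ∧
      IsRegularityIndex (hilbertFunction K X.component) r ∧
      IsRegularityIndex (hilbertFunction K (kaehlerComponent K X.component))
        (2 * (r : ℤ) + 1)) := by
  refine ⟨fun n X hX => ?_, fun r => ?_⟩
  · have hδ := ZeroDimSubscheme.isDehomogenization_deh hX
    have : Module.Finite K X.affineRing := X.finite_affineRing
    have : Nontrivial X.affineRing := hδ.nontrivial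
    obtain ⟨r, hr⟩ := hδ.exists_isRegularityIndex
    have hΩ : ∀ i : ℤ, 2 * r + 1 ≤ i →
        hilbertFunction K (kaehlerComponent K X.component) i =
          Module.finrank K X.affineRing + Module.finrank K (Ω[X.affineRing⁄K]) :=
      fun i hi => hδ.hilbertFunction_kaehlerComponent hr hi
    obtain ⟨ρ, hρ, hρ'⟩ := exists_isRegularityIndex (fun i hi => by
        rw [hilbertFunction, X.kaehlerComponent_eq_bot hi.le, finrank_bot])
      (Nat.add_pos_left Module.finrank_pos _).ne' hΩ
    refine ⟨hδ.finite_component, hδ.finite_kaehlerComponent, inferInstance,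
      finite_kaehlerDifferential K X.affineRing, hδ.incl_injective,
      ⟨hδ.truncEquiv, fun k f hf => hδ.truncEquiv_incl_of_mem hf, hδ.map_truncComponent,
        hδ.splitEquiv, hδ.splitEquiv_x_zero_smul, hδ.map_kaehlerComponent,
        hδ.splitEquiv_smul_D_x_zero, hδ.splitEquiv_symm_monomial_smul_D,
        fun k f hf i _ => hδ.splitEquiv_Phi hf i, fun k f hf => hδ.splitEquiv_Phi_x_zero hf⟩,
      X.mapsTo_Phi, hδ.ker_Phi, r, Module.finrank K X.affineRing, hr,
      hδ.hasHilbertPolynomial_component, fun i hi => hδ.bijOn_Phi hr hi,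
      eventually_atTop.2 ⟨_, hΩ⟩, ρ, hρ', hρ⟩
  · obtain ⟨f, hf, hs, hd⟩ := Polynomial.exists_monic_separable K r
    have hd0 : f.natDegree ≠ 0 := hd ▸ r.succ_ne_zero
    have hr := ZeroDimSubscheme.isRegularityIndex_zeroScheme hf hd0
    rw [hd, Nat.cast_add, Nat.cast_one, add_sub_cancel_right] at hr
    exact ⟨1, ZeroDimSubscheme.zeroScheme f hf hd0,
      (ZeroDimSubscheme.isDehomogenization_zeroSchemeDeh hf hd0).avoidsHyperplane, hr,
      ZeroDimSubscheme.isRegularityIndex_kaehlerComponent_zeroScheme hf hd0 hs hd⟩
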